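/- A \emph{graph} is finite, simple and undirected; a graph \emph{contains} a graph $F$ if some induced subgraph of it is isomorphic to $F$. A \emph{path} is a graph whose vertices can be ordered $v_0,\dots,v_k$ so that $v_iv_j$ is an edge if and only if $|i-j|=1$; its ends are $v_0,v_k$ and its length is $k$. A \emph{prism} is a graph whose vertex set is partitioned into three sets inducing paths $P_1,P_2,P_3$, where $P_i$ has length at least $1$ and ends $a_i,b_i$, such that $\{a_1,a_2,a_3\}$ and $\{b_1,b_2,b_3\}$ are triangles and there are no edges between $P_i$ and $P_j$ ($i\ne j$) other than those of these two triangles. A \emph{pyramid} is a graph whose vertex set is the union of three sets inducing paths $P_1,P_2,P_3$, where $P_i$ has length at least $1$ and ends $a,b_i$, such that $a$ is the only vertex that lies on more than one of the paths, $\{b_1,b_2,b_3\}$ is a triangle, there are no edges between $P_i$ and $P_j$ ($i\ne j$) other than those of the triangle and those with end $a$, and at most one of the three paths has length $1$. A graph is \emph{Berge} if it contains neither an odd hole (a chordless cycle with an odd number $k\ge 5$ of vertices) nor the complement of an odd hole. \textbf{Statement.} There are a single algorithm (a program for a unit-cost random access machine whose elementary operations are constants, copies, successor, predecessor, indirect reads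 and writes in arrays, and comparisons of registers) and a constant $C$ such that the following holds for every graph $G$ with vertex set $\{0,\dots,n-1\}$ and $m$ edges, given by adjacency lists in any order. The algorithm halts after at most $C\,(n^3(n+m)+1)$ steps, that is, in time $O(n^3(n+m))$, and answers either ``there is a prism or a pyramid'' or ``neither prism nor pyramid''; it gives the first answer if and only if $G$ contains a prism or a pyramid. Consequently, if $G$ contains no pyramid, the first answer is given if and only if $G$ contains a prism; this applies in particular to every Berge graph, since a Berge graph contains no pyramid. -/

import Mathlib

/-! ## Prisms, pyramids, Berge graphs

A path is a graph isomorphic to `SimpleGraph.pathGraph (k + 1)` (vertices `0, …, k`, consecutive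
numbers adjacent, length `k`), so a set of vertices inducing a path of length `k` is the range of
an embedding `pathGraph (k + 1) ↪g F`, whose ends are the images of `0` and `Fin.last k`. -/

namespace SimpleGraph

/-- `F` is a prism: its vertices are partitioned into three sets inducing paths `P 0, P 1, P 2`
of lengths `k i ≥ 1`, with ends `a i = P i 0` and `b i = P i (Fin.last (k i))`, such that
`{a 0, a 1, a 2}` and `{b 0, b 1, b 2}` are triangles, and these triangles contain
all the edges between different paths. -/
def IsPrism {W : Type*} (F : SimpleGraph W) : Prop :=
  ∃ (k : Fin 3 → ℕ) (P : ∀ i, pathGraph (k i + 1) ↪g F),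
    (∀ i, 1 ≤ k i) ∧
    (∀ w, ∃! i, w ∈ Set.range (P i)) ∧
    (∀ i j, i ≠ j → F.Adj (P i 0) (P j 0)) ∧
    (∀ i j, i ≠ j → F.Adj (P i (Fin.last (k i))) (P j (Fin.last (k j)))) ∧
    (∀ i j, i ≠ j → ∀ x y, F.Adj (P i x) (P j y) →
      (x = 0 ∧ y = 0) ∨ (x = Fin.last (k i) ∧ y = Fin.last (k j)))

/-- `F` is a pyramid: its vertex set is the union of three sets inducing paths `P 0, P 1, P 2` of
lengths `k i ≥ 1`, with ends `a` and `b i = P i (Fin.last (k i))`, such that `{b 0, b 1, b 2}` is a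
triangle, `a` is the only vertex lying on two of the paths, the only edges between
different paths are those of the triangle and those with end `a`, and at most one of the paths has
length one. -/
def IsPyramid {W : Type*} (F : SimpleGraph W) : Prop :=
  ∃ (a : W) (k : Fin 3 → ℕ) (P : ∀ i, pathGraph (k i + 1) ↪g F),
    (∀ i, 1 ≤ k i) ∧
    (∀ i, P i 0 = a) ∧
    (∀ w, ∃ i, w ∈ Set.range (P i)) ∧
    (∀ i j, i ≠ j → ∀ x y, P i x = P j y → P i x = a) ∧
    (∀ i j, i ≠ j → F.Adj (P i (Fin.last (k i))) (P j (Fin.last (k j)))) ∧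
    (∀ i j, i ≠ j → ∀ x y, F.Adj (P i x) (P j y) →
      (P i x = a ∨ P j y = a) ∨ (x = Fin.last (k i) ∧ y = Fin.last (k j))) ∧
    (∀ i j, k i = 1 → k j = 1 → i = j)

/-- `G` contains a prism, as an induced subgraph. -/
def ContainsPrism {V : Type*} (G : SimpleGraph V) : Prop :=
  ∃ S : Set V, IsPrism (G.induce S)

/-- `G` contains a pyramid, as an induced subgraph. -/
def ContainsPyramid {V : Type*} (G : SimpleGraph V) : Prop :=
  ∃ S : Set V, IsPyramid (G.induce S)

/-- An odd hole: a chordless cycle with at least four vertices and an odd number of them. -/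
def IsOddHole {W : Type*} (F : SimpleGraph W) : Prop :=
  ∃ k, 4 ≤ k ∧ Odd k ∧ Nonempty (cycleGraph k ≃g F)

/-- A Berge graph: no induced subgraph is an odd hole or the complement of an odd hole. -/
def IsBerge {V : Type*} (G : SimpleGraph V) : Prop :=
  ∀ S : Set V, ¬ IsOddHole (G.induce S) ∧ ¬ IsOddHole (G.induce S)ᶜ

end SimpleGraph

/-! ## Random access machine with unit costs

Programs act on registers and on arrays of natural numbers, with indirect addressing. The only
arithmetic operations are the successor and the predecessor, so an execution of `t` steps increases
the largest number in memory by at most `t` plus a constant of the program: numbers keep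
logarithmically many bits in polynomial time, and the unit cost hides no computation. -/

namespace RAM

/-- A memory: the contents of register `r` is `reg r`, that of cell `i` of array `a` is
`arr a i`. A program mentions only finitely many registers and arrays. -/
structure State where
  reg : ℕ → ℕ
  arr : ℕ → ℕ → ℕ

namespace State

/-- Store `v` in register `r`. -/
def setReg (σ : State) (r v : ℕ) : State :=
  { σ with reg := Function.update σ.reg r v }

/-- Store `v` in cell `i` of array `a`. -/
def setArr (σ : State) (a i v : ℕ) : State :=
  { σ with arr := Function.update σ.arr a (Function.update (σ.arr a) i v) }

end State

/-- Elementary operations; `r`, `s` are names of registers and `a` is the name of an array. -/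
inductive Op where
  /-- `r := c` -/
  | const (r c : ℕ)
  /-- `r := s` -/
  | copy (r s : ℕ)
  /-- `r := r + 1` -/
  | succ (r : ℕ)
  /-- `r := r - 1`, and `0` stays `0` -/
  | pred (r : ℕ)
  /-- `r := a[s]` -/
  | load (r a s : ℕ)
  /-- `a[r] := s` -/
  | store (a r s : ℕ)

/-- The effect of an elementary operation. -/
def Op.apply : Op → State → State
  | .const r c, σ => σ.setReg r c
  | .copy r s, σ => σ.setReg r (σ.reg s)
  | .succ r, σ => σ.setReg r (σ.reg r + 1)
  | .pred r, σ => σ.setReg r (σ.reg r - 1)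
  | .load r a s, σ => σ.setReg r (σ.arr a (σ.reg s))
  | .store a r s, σ => σ.setArr a (σ.reg r) (σ.reg s)

/-- Elementary tests: comparisons of two registers. -/
inductive Test where
  | eq (r s : ℕ)
  | lt (r s : ℕ)

/-- The outcome of a test. -/
def Test.holds : Test → State → Prop
  | .eq r s, σ => σ.reg r = σ.reg s
  | .lt r s, σ => σ.reg r < σ.reg s

/-- Programs. -/
inductive Prog where
  | skip
  | op (o : Op)
  | seq (p q : Prog)
  | ite (b : Test) (p q : Prog)
  | loop (b : Test) (p : Prog)

/-- `Exec p σ t τ`: started in memory `σ`, the program `p` halts after exactly `t` steps, in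
memory `τ`. Every elementary operation and every evaluation of a test costs one step
(and so does `skip`). `loop b p` is the loop "while `b` do `p`". -/
inductive Exec : Prog → State → ℕ → State → Prop
  | skip (σ : State) : Exec .skip σ 1 σ
  | op (o : Op) (σ : State) : Exec (.op o) σ 1 (o.apply σ)
  | seq {p q : Prog} {σ τ υ : State} {t u : ℕ} :
      Exec p σ t τ → Exec q τ u υ → Exec (.seq p q) σ (t + u) υ
  | ite_true {b : Test} {p q : Prog} {σ τ : State} {t : ℕ} :
      b.holds σ → Exec p σ t τ → Exec (.ite b p q) σ (1 + t) τ
  | ite_false {b : Test} {p q : Prog} {σ τ : State} {t : ℕ} :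
      ¬ b.holds σ → Exec q σ t τ → Exec (.ite b p q) σ (1 + t) τ
  | loop_false {b : Test} {p : Prog} {σ : State} :
      ¬ b.holds σ → Exec (.loop b p) σ 1 σ
  | loop_true {b : Test} {p : Prog} {σ τ υ : State} {t u : ℕ} :
      b.holds σ → Exec p σ t τ → Exec (.loop b p) τ u υ →
      Exec (.loop b p) σ (1 + t + u) υ

/-- Executions are deterministic: number of steps and final memory are determined by the program
and the initial memory. -/
theorem Exec.deterministic {p : Prog} {σ τ τ' : State} {t t' : ℕ}
    (h : Exec p σ t τ) (h' : Exec p σ t' τ') : t = t' ∧ τ = τ' := by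
  induction h generalizing t' τ' with
  | skip σ => cases h'; exact ⟨rfl, rfl⟩
  | op o σ => cases h'; exact ⟨rfl, rfl⟩
  | seq _ _ ih1 ih2 =>
    cases h' with
    | seq h1 h2 =>
      obtain ⟨rfl, rfl⟩ := ih1 h1
      obtain ⟨rfl, rfl⟩ := ih2 h2
      exact ⟨rfl, rfl⟩
  | ite_true hb _ ih =>
    cases h' with
    | ite_true _ h1 => obtain ⟨rfl, rfl⟩ := ih h1; exact ⟨rfl, rfl⟩
    | ite_false hn _ => exact absurd hb hn
  | ite_false hb _ ih =>
    cases h' with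
    | ite_true hn _ => exact absurd hn hb
    | ite_false _ h1 => obtain ⟨rfl, rfl⟩ := ih h1; exact ⟨rfl, rfl⟩
  | loop_false hb =>
    cases h' with
    | loop_false _ => exact ⟨rfl, rfl⟩
    | loop_true hn _ _ => exact absurd hn hb
  | loop_true hb _ _ ih1 ih2 =>
    cases h' with
    | loop_false hn => exact absurd hb hn
    | loop_true _ h1 h2 =>
      obtain ⟨rfl, rfl⟩ := ih1 h1
      obtain ⟨rfl, rfl⟩ := ih2 h2
      exact ⟨rfl, rfl⟩

end RAM

/-! ## Graphs as inputs: adjacency lists -/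

/-- A representation of `G` by adjacency lists: for each vertex the list of its neighbours, each
listed once, in arbitrary order. -/
structure AdjLists {n : ℕ} (G : SimpleGraph (Fin n)) where
  nbrs : Fin n → List (Fin n)
  nodup : ∀ v, (nbrs v).Nodup
  mem_iff : ∀ v w, w ∈ nbrs v ↔ G.Adj v w

namespace AdjLists

variable {n : ℕ} {G : SimpleGraph (Fin n)}

/-- The concatenation of the lists of the vertices `0, 1, …, n - 1`. -/
def flat (L : AdjLists G) : List ℕ :=
  (List.finRange n).flatMap fun v => (L.nbrs v).map Fin.val

/-- The position in `flat` at which the list of vertex `i` starts (for `i = n`: the total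
length). -/
def start (L : AdjLists G) (i : ℕ) : ℕ :=
  (((List.finRange n).take i).map fun v => (L.nbrs v).length).sum

/-- The initial memory: register `0` contains `n`; array `0` contains `start 0, …, start n`;
array `1` contains the concatenated lists, so that the neighbours of `v` are in the cells `k` of
array `1` with `start v ≤ k < start (v + 1)`. The rest of the memory is zero. -/
def input (L : AdjLists G) : RAM.State where
  reg r := if r = 0 then n else 0
  arr a i :=
    if a = 0 then (if i ≤ n then L.start i else 0)
    else if a = 1 then L.flat.getD i 0
    else 0

end AdjLists

/-! Prisms and pyramids are detected together through one notion, the linked triangle. Take a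
triangle `b₁ b₂ b₃`; a private neighbour of `bᵢ` is adjacent to `bᵢ` and to no other corner, and a
far vertex is adjacent to no corner. The triangle is linked if some private neighbour `c` of `b₁`
has a neighbour reachable through far vertices from private neighbours of `b₂`, and likewise for
`b₃`. `containsPrism_or_containsPyramid_iff` shows that a linked triangle exists exactly when there
is a prism or a pyramid.

In a prism, either triangle is linked along the three paths; in a pyramid the triangle is, provided
`b₁` is the corner whose path may have length one. Conversely, a shortest link from `b₂` to a
neighbour of `c` closes up, through `c` and `b₁`, to a hole containing the edge `b₁ b₂`. From `b₃`,
a shortest link towards the rest of this hole gives a path whose last vertex alone attaches there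
(`IsHoleWithPath`). According to whether the extreme attachments coincide, are consecutive, or are
further apart, the result is a pyramid, a prism, or a pyramid. The two links need not avoid each
other: the second stops as soon as it sees the hole.

For one triple, classifying vertices, two breadth-first searches and a final scan take time O(n +
m), so all triples take O(n³(n + m)), lower order terms being absorbed. `Runs` carries the exact
step count, `Runs.loop` bounds loops by a potential, and `AgreeOutside` tells what a program leaves
untouched.

A Berge graph has no pyramid, because two paths of a pyramid with lengths of equal parity form an
odd hole. -/

namespace SimpleGraph

/-! ### Prisms and pyramids given by paths indexed by natural numbers. -/

variable {V : Type*} {G : SimpleGraph V}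

/-- The vertices `f 0, …, f k` are distinct and induce a path, in this order. -/
structure IsInducedPath (G : SimpleGraph V) (f : ℕ → V) (k : ℕ) : Prop where
  inj : ∀ x ≤ k, ∀ y ≤ k, f x = f y → x = y
  adj : ∀ x ≤ k, ∀ y ≤ k, (G.Adj (f x) (f y) ↔ x + 1 = y ∨ y + 1 = x)

/-- An induced path as an embedding into an induced subgraph that contains it. -/
def IsInducedPath.toEmbedding {f : ℕ → V} {k : ℕ} (h : G.IsInducedPath f k) (S : Set V)
    (hS : ∀ x ≤ k, f x ∈ S) : pathGraph (k + 1) ↪g G.induce S where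
  toFun x := ⟨f x, hS x (by omega)⟩
  inj' x y hxy := by
    have := h.inj x (by omega) y (by omega) (by simpa using hxy)
    exact Fin.ext this
  map_rel_iff' {x y} := by
    simp only [comap_adj, Function.Embedding.subtype_apply,
      pathGraph_adj]
    exact h.adj x (by omega) y (by omega)

/-- An embedded path as a function on the natural numbers. -/
theorem exists_isInducedPath {k : ℕ} (P : pathGraph (k + 1) ↪g G) :
    ∃ f : ℕ → V, G.IsInducedPath f k ∧ (∀ x : Fin (k + 1), P x = f x) ∧
      ∀ x (h : x ≤ k), f x = P ⟨x, by omega⟩ := by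
  refine ⟨fun x => P ⟨min x k, by omega⟩, ⟨?_, ?_⟩, ?_, ?_⟩
  · intro x hx y hy hxy
    have := congrArg Fin.val (P.injective hxy)
    simp only at this
    omega
  · intro x hx y hy
    rw [P.map_adj_iff, pathGraph_adj]
    simp only
    omega
  · intro x
    congr 1
    ext
    simp only
    omega
  · intro x hx
    simp only [min_eq_left hx]

/-- The induced subgraph is the union of the three paths. By symmetry the conditions are needed only
for `i < j`, which leaves three cases in each application. -/
theorem containsPrism_of_paths (f : Fin 3 → ℕ → V) (k : Fin 3 → ℕ) (hk : ∀ i, 1 ≤ k i)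
    (hp : ∀ i, G.IsInducedPath (f i) (k i))
    (hdisj : ∀ i j, i < j → ∀ x ≤ k i, ∀ y ≤ k j, f i x ≠ f j y)
    (hadj : ∀ i j, i < j → ∀ x ≤ k i, ∀ y ≤ k j,
      (G.Adj (f i x) (f j y) ↔ (x = 0 ∧ y = 0) ∨ (x = k i ∧ y = k j))) :
    G.ContainsPrism := by
  have hdisj' : ∀ i j, i ≠ j → ∀ x ≤ k i, ∀ y ≤ k j, f i x ≠ f j y := by
    intro i j hij x hx y hy
    rcases lt_or_gt_of_ne hij with h | h
    · exact hdisj i j h x hx y hy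
    · exact (hdisj j i h y hy x hx).symm
  have hadj' : ∀ i j, i ≠ j → ∀ x ≤ k i, ∀ y ≤ k j,
      (G.Adj (f i x) (f j y) ↔ (x = 0 ∧ y = 0) ∨ (x = k i ∧ y = k j)) := by
    intro i j hij x hx y hy
    rcases lt_or_gt_of_ne hij with h | h
    · exact hadj i j h x hx y hy
    · rw [G.adj_comm, hadj j i h y hy x hx]
      tauto
  refine ⟨{v | ∃ i, ∃ x ≤ k i, f i x = v}, k,
    fun i => (hp i).toEmbedding _ (fun x hx => ⟨i, x, hx, rfl⟩), hk, ?_, ?_, ?_, ?_⟩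
  · rintro ⟨w, i, x, hx, rfl⟩
    refine ⟨i, ⟨⟨x, by omega⟩, rfl⟩, ?_⟩
    rintro j ⟨y, hy⟩
    by_contra hij
    exact hdisj' j i hij y (by omega) x hx (congrArg Subtype.val hy)
  · intro i j hij
    exact (hadj' i j hij 0 (by omega) 0 (by omega)).2 (Or.inl ⟨rfl, rfl⟩)
  · intro i j hij
    exact (hadj' i j hij (k i) le_rfl (k j) le_rfl).2 (Or.inr ⟨rfl, rfl⟩)
  · intro i j hij x y h
    exact ((hadj' i j hij x (by omega) y (by omega)).1 h).imp
      (fun h => ⟨Fin.ext h.1, Fin.ext h.2⟩) (fun h => ⟨Fin.ext h.1, Fin.ext h.2⟩)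

/-- All indices `0` denote the apex, whose adjacencies are already fixed by the paths; hence
disjointness and adjacency between paths are required at positive indices only. -/
theorem containsPyramid_of_paths (a : V) (f : Fin 3 → ℕ → V) (k : Fin 3 → ℕ)
    (hk : ∀ i, 1 ≤ k i) (hp : ∀ i, G.IsInducedPath (f i) (k i)) (ha : ∀ i, f i 0 = a)
    (hdisj : ∀ i j, i < j → ∀ x ≤ k i, ∀ y ≤ k j, 1 ≤ x → 1 ≤ y → f i x ≠ f j y)
    (hadj : ∀ i j, i < j → ∀ x ≤ k i, ∀ y ≤ k j, 1 ≤ x → 1 ≤ y →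
      (G.Adj (f i x) (f j y) ↔ (x = k i ∧ y = k j)))
    (hone : ∀ i j, i < j → k i = 1 → k j ≠ 1) :
    G.ContainsPyramid := by
  have hdisj' : ∀ i j, i ≠ j → ∀ x ≤ k i, ∀ y ≤ k j, 1 ≤ x → 1 ≤ y → f i x ≠ f j y := by
    intro i j hij x hx y hy hx1 hy1
    rcases lt_or_gt_of_ne hij with h | h
    · exact hdisj i j h x hx y hy hx1 hy1
    · exact (hdisj j i h y hy x hx hy1 hx1).symm
  have hadj' : ∀ i j, i ≠ j → ∀ x ≤ k i, ∀ y ≤ k j, 1 ≤ x → 1 ≤ y →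
      (G.Adj (f i x) (f j y) ↔ (x = k i ∧ y = k j)) := by
    intro i j hij x hx y hy hx1 hy1
    rcases lt_or_gt_of_ne hij with h | h
    · exact hadj i j h x hx y hy hx1 hy1
    · rw [G.adj_comm, hadj j i h y hy x hx hy1 hx1]
      tauto
  have haS : a ∈ {v | ∃ i, ∃ x ≤ k i, f i x = v} := ⟨0, 0, by omega, ha 0⟩
  refine ⟨{v | ∃ i, ∃ x ≤ k i, f i x = v}, ⟨a, haS⟩, k,
    fun i => (hp i).toEmbedding _ (fun x hx => ⟨i, x, hx, rfl⟩), hk, ?_, ?_, ?_, ?_, ?_, ?_⟩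
  · intro i
    exact Subtype.ext (ha i)
  · rintro ⟨w, i, x, hx, rfl⟩
    exact ⟨i, ⟨x, by omega⟩, rfl⟩
  · intro i j hij x y hxy
    have hxy' : f i x = f j y := congrArg Subtype.val hxy
    apply Subtype.ext
    change f i x = a
    by_cases hx : (x : ℕ) = 0
    · rw [hx, ha]
    by_cases hy : (y : ℕ) = 0
    · rw [hxy', hy, ha]
    exact absurd hxy' (hdisj' i j hij x (by omega) y (by omega) (by omega) (by omega))
  · intro i j hij
    exact (hadj' i j hij (k i) le_rfl (k j) le_rfl (hk i) (hk j)).2 ⟨rfl, rfl⟩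
  · intro i j hij x y h
    by_cases hx : (x : ℕ) = 0
    · exact Or.inl (Or.inl (Subtype.ext (by change f i x = a; rw [hx, ha])))
    by_cases hy : (y : ℕ) = 0
    · exact Or.inl (Or.inr (Subtype.ext (by change f j y = a; rw [hy, ha])))
    have := (hadj' i j hij x (by omega) y (by omega) (by omega) (by omega)).1 h
    exact Or.inr ⟨Fin.ext this.1, Fin.ext this.2⟩
  · intro i j hi hj
    by_contra hij
    rcases lt_or_gt_of_ne hij with h | h
    · exact hone i j h hi hj
    · exact hone j i h hj hi

/-! ### A hole with an attached path yields a prism or a pyramid. -/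

/-- A hole `h 0, …, h L` together with a path `g 0, …, g M` outside it, such that `g 0` completes
the edge `h 0 h L` to a triangle and apart from this only `g M` has neighbours in the hole. -/
structure IsHoleWithPath (G : SimpleGraph V) (h : ℕ → V) (L : ℕ) (g : ℕ → V) (M : ℕ) : Prop where
  three_le : 3 ≤ L
  one_le : 1 ≤ M
  inj : ∀ x ≤ L, ∀ y ≤ L, h x = h y → x = y
  adj : ∀ x ≤ L, ∀ y ≤ L, (G.Adj (h x) (h y) ↔
    x + 1 = y ∨ y + 1 = x ∨ (x = 0 ∧ y = L) ∨ (x = L ∧ y = 0))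
  path : G.IsInducedPath g M
  disj : ∀ x ≤ L, ∀ y ≤ M, h x ≠ g y
  cross : ∀ x ≤ L, ∀ y < M, (G.Adj (h x) (g y) ↔ y = 0 ∧ (x = 0 ∨ x = L))
  attach : ∃ x, 0 < x ∧ x < L ∧ G.Adj (h x) (g M)
  not_adj_zero : ¬ G.Adj (h 0) (g M)
  not_adj_last : ¬ G.Adj (h L) (g M)

-- Let `h p` and `h q` be the first and last neighbours of `g M` on the hole, so `0 < p ≤ q < L`.
-- The triangle `h 0, h L, g 0` is always used; the other end of the structure depends on `q - p`,
-- and hole vertices strictly between `h p` and `h q` are discarded.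
set_option maxHeartbeats 1000000 in
theorem IsHoleWithPath.containsPrism_or_containsPyramid {h g : ℕ → V} {L M : ℕ}
    (H : G.IsHoleWithPath h L g M) : G.ContainsPrism ∨ G.ContainsPyramid := by
  classical
  obtain ⟨hL, hM, hinj, hadj, hg, hdisj, hcross, hatt, h0, hl⟩ := H
  obtain ⟨p, q, hpq, hp0, hqL, hp, hq, hbet⟩ : ∃ p q, p ≤ q ∧ 0 < p ∧ q < L ∧
      G.Adj (h p) (g M) ∧ G.Adj (h q) (g M) ∧
      ∀ x ≤ L, G.Adj (h x) (g M) → p ≤ x ∧ x ≤ q := by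
    have hne : ((Finset.range (L + 1)).filter fun x => G.Adj (h x) (g M)).Nonempty := by
      obtain ⟨x, _, hx, hxa⟩ := hatt
      exact ⟨x, by simp only [Finset.mem_filter, Finset.mem_range]; exact ⟨by omega, hxa⟩⟩
    have hp := Finset.min'_mem _ hne
    have hq := Finset.max'_mem _ hne
    refine ⟨_, _, Finset.min'_le_max' _ hne, ?_, ?_, (Finset.mem_filter.1 hp).2,
      (Finset.mem_filter.1 hq).2, ?_⟩
    · rw [Nat.pos_iff_ne_zero]
      intro h'
      have := (Finset.mem_filter.1 hp).2
      rw [h'] at this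
      exact h0 this
    · have h1 := (Finset.mem_filter.1 hq).1
      rw [Finset.mem_range] at h1
      refine lt_of_le_of_ne (by omega) ?_
      intro h'
      have := (Finset.mem_filter.1 hq).2
      rw [h'] at this
      exact hl this
    · intro x hx hxa
      have : x ∈ (Finset.range (L + 1)).filter fun x => G.Adj (h x) (g M) := by
        simp only [Finset.mem_filter, Finset.mem_range]; exact ⟨by omega, hxa⟩
      exact ⟨Finset.min'_le _ _ this, Finset.le_max' _ _ this⟩
  have hM' : ∀ x ≤ L, x < p ∨ q < x → ¬ G.Adj (h x) (g M) := by
    intro x hx hxp hxa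
    have := hbet x hx hxa
    omega
  have hcr : ∀ x ≤ L, x < p ∨ q < x → ∀ y ≤ M,
      (G.Adj (h x) (g y) ↔ y = 0 ∧ (x = 0 ∨ x = L)) := by
    intro x hx hxp y hy
    rcases hy.lt_or_eq with hy | rfl
    · exact hcross x hx y hy
    · simp only [hM' x hx hxp, false_iff]
      omega
  rcases hpq.eq_or_lt with rfl | hlt
  · right
    -- Only one attachment: the apex is `h p`, with both arcs of the hole and the reversed path `g`
    -- as legs. The arcs cannot both have length one since `3 ≤ L`, and the third leg has length `M
    -- + 1 ≥ 2`.
    refine containsPyramid_of_paths (h p)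
      ![fun t => h (p - t), fun t => h (p + t), fun t => if t = 0 then h p else g (M + 1 - t)]
      ![p, L - p, M + 1] ?_ ?_ ?_ ?_ ?_ ?_
    · intro i; fin_cases i <;> simp <;> omega
    · intro i
      fin_cases i
      · refine ⟨fun x hx y hy hxy => ?_, fun x hx y hy => ?_⟩ <;> simp at hx hy
        · have := hinj _ (by omega) _ (by omega) hxy
          omega
        · simp only [Fin.zero_eta, Matrix.cons_val_zero]
          rw [hadj _ (by omega) _ (by omega)]
          omega
      · refine ⟨fun x hx y hy hxy => ?_, fun x hx y hy => ?_⟩ <;> simp at hx hy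
        · have := hinj _ (by omega) _ (by omega) hxy
          omega
        · simp only [Fin.mk_one, Matrix.cons_val_one, Matrix.cons_val_zero]
          rw [hadj _ (by omega) _ (by omega)]
          omega
      · refine ⟨fun x hx y hy hxy => ?_, fun x hx y hy => ?_⟩ <;>
          simp only [Fin.reduceFinMk, Matrix.cons_val] at *
        · split_ifs at hxy with h1 h2 h2
          · omega
          · exact absurd hxy (hdisj _ (by omega) _ (by omega))
          · exact absurd hxy.symm (hdisj _ (by omega) _ (by omega))
          · have := hg.inj _ (by omega) _ (by omega) hxy
            omega
        · split_ifs with h1 h2 h2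
          · simp only [SimpleGraph.irrefl, false_iff]
            omega
          · rcases (show y = 1 ∨ M + 1 - y < M by omega) with rfl | h3
            · simp [hp, h1]
            · rw [hcross _ (by omega) _ h3]
              omega
          · rw [G.adj_comm]
            rcases (show x = 1 ∨ M + 1 - x < M by omega) with rfl | h3
            · simp [hp, h2]
            · rw [hcross _ (by omega) _ h3]
              omega
          · rw [hg.adj _ (by omega) _ (by omega)]
            omega
    · intro i; fin_cases i <;> simp
    · intro i j hij
      fin_cases i <;> fin_cases j <;> simp at hij <;> intro x hx y hy hx1 hy1 hxy <;> simp at *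
      · have := hinj _ (by omega) _ (by omega) hxy
        omega
      · rw [if_neg (by omega)] at hxy
        exact hdisj _ (by omega) _ (by omega) hxy
      · rw [if_neg (by omega)] at hxy
        exact hdisj _ (by omega) _ (by omega) hxy
    · intro i j hij
      fin_cases i <;> fin_cases j <;> simp at hij <;> intro x hx y hy hx1 hy1 <;> simp at *
      · rw [hadj _ (by omega) _ (by omega)]
        omega
      · rw [if_neg (by omega), hcr _ (by omega) (by omega) _ (by omega)]
        omega
      · rw [if_neg (by omega), hcr _ (by omega) (by omega) _ (by omega)]
        omega
    · intro i j hij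
      fin_cases i <;> fin_cases j <;> simp at hij <;> simp <;> omega
  rcases (show q = p + 1 ∨ p + 2 ≤ q by omega) with rfl | hlt2
  · left
    -- Two consecutive attachments: the second triangle is `h p, h (p + 1), g M`.
    refine containsPrism_of_paths
      ![fun t => h (p - t), fun t => h (p + 1 + t), fun t => g (M - t)]
      ![p, L - (p + 1), M] ?_ ?_ ?_ ?_
    · intro i; fin_cases i <;> simp <;> omega
    · intro i
      fin_cases i <;> refine ⟨fun x hx y hy hxy => ?_, fun x hx y hy => ?_⟩ <;> simp at *
      · have := hinj _ (by omega) _ (by omega) hxy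
        omega
      · rw [hadj _ (by omega) _ (by omega)]
        omega
      · have := hinj _ (by omega) _ (by omega) hxy
        omega
      · rw [hadj _ (by omega) _ (by omega)]
        omega
      · have := hg.inj _ (by omega) _ (by omega) hxy
        omega
      · rw [hg.adj _ (by omega) _ (by omega)]
        omega
    · intro i j hij
      fin_cases i <;> fin_cases j <;> simp at hij <;> intro x hx y hy hxy <;> simp at *
      · have := hinj _ (by omega) _ (by omega) hxy
        omega
      · exact hdisj _ (by omega) _ (by omega) hxy
      · exact hdisj _ (by omega) _ (by omega) hxy
    · intro i j hij
      fin_cases i <;> fin_cases j <;> simp at hij <;> intro x hx y hy <;> simp at *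
      · rw [hadj _ (by omega) _ (by omega)]
        omega
      · rcases Nat.eq_zero_or_pos x with rfl | hx1
        · rcases Nat.eq_zero_or_pos y with rfl | hy1
          · simp [hp]
          · rw [hcross _ (by omega) _ (by omega)]
            omega
        · rw [hcr _ (by omega) (by omega) _ (by omega)]
          omega
      · rcases Nat.eq_zero_or_pos x with rfl | hx1
        · rcases Nat.eq_zero_or_pos y with rfl | hy1
          · simp [hq]
          · rw [hcross _ (by omega) _ (by omega)]
            omega
        · rw [hcr _ (by omega) (by omega) _ (by omega)]
          omega
  · right
    have key : ∀ x ≤ L, x ≤ p ∨ q ≤ x → (G.Adj (g M) (h x) ↔ x = p ∨ x = q) := by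
      intro x hx hx'
      refine ⟨fun ha => ?_, ?_⟩
      · have := hbet x hx ha.symm
        omega
      · rintro (rfl | rfl)
        exacts [hp.symm, hq.symm]
    -- Extreme attachments that are distinct and not consecutive: the apex is `g M`. The legs
    -- through `h p` and `h q` have length at least two, so `M = 1` is harmless.
    refine containsPyramid_of_paths (g M)
      ![fun t => if t = 0 then g M else h (p + 1 - t),
        fun t => if t = 0 then g M else h (q + t - 1), fun t => g (M - t)]
      ![p + 1, L - q + 1, M] ?_ ?_ ?_ ?_ ?_ ?_
    · intro i; fin_cases i <;> simp <;> omega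
    · intro i
      fin_cases i
      · refine ⟨fun x hx y hy hxy => ?_, fun x hx y hy => ?_⟩ <;> simp at *
        · split_ifs at hxy with h1 h2 h2
          · omega
          · exact absurd hxy.symm (hdisj _ (by omega) _ (by omega))
          · exact absurd hxy (hdisj _ (by omega) _ (by omega))
          · have := hinj _ (by omega) _ (by omega) hxy
            omega
        · split_ifs with h1 h2 h2
          · simp only [SimpleGraph.irrefl, false_iff]
            omega
          · rw [key _ (by omega) (by omega)]
            omega
          · rw [G.adj_comm, key _ (by omega) (by omega)]
            omega
          · rw [hadj _ (by omega) _ (by omega)]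
            omega
      · refine ⟨fun x hx y hy hxy => ?_, fun x hx y hy => ?_⟩ <;> simp at *
        · split_ifs at hxy with h1 h2 h2
          · omega
          · exact absurd hxy.symm (hdisj _ (by omega) _ (by omega))
          · exact absurd hxy (hdisj _ (by omega) _ (by omega))
          · have := hinj _ (by omega) _ (by omega) hxy
            omega
        · split_ifs with h1 h2 h2
          · simp only [SimpleGraph.irrefl, false_iff]
            omega
          · rw [key _ (by omega) (by omega)]
            omega
          · rw [G.adj_comm, key _ (by omega) (by omega)]
            omega
          · rw [hadj _ (by omega) _ (by omega)]
            omega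
      · refine ⟨fun x hx y hy hxy => ?_, fun x hx y hy => ?_⟩ <;> simp at *
        · have := hg.inj _ (by omega) _ (by omega) hxy
          omega
        · rw [hg.adj _ (by omega) _ (by omega)]
          omega
    · intro i; fin_cases i <;> simp
    · intro i j hij
      fin_cases i <;> fin_cases j <;> simp at hij <;> intro x hx y hy hx1 hy1 hxy <;> simp at *
      · rw [if_neg (by omega), if_neg (by omega)] at hxy
        have := hinj _ (by omega) _ (by omega) hxy
        omega
      · rw [if_neg (by omega)] at hxy
        exact hdisj _ (by omega) _ (by omega) hxy
      · rw [if_neg (by omega)] at hxy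
        exact hdisj _ (by omega) _ (by omega) hxy
    · intro i j hij
      fin_cases i <;> fin_cases j <;> simp at hij <;> intro x hx y hy hx1 hy1 <;> simp at *
      · rw [if_neg (by omega), if_neg (by omega), hadj _ (by omega) _ (by omega)]
        omega
      · rw [if_neg (by omega), hcross _ (by omega) _ (by omega)]
        omega
      · rw [if_neg (by omega), hcross _ (by omega) _ (by omega)]
        omega
    · intro i j hij
      fin_cases i <;> fin_cases j <;> simp at hij <;> simp <;> omega

end SimpleGraph

/-! ### Linked triangles and shortest walks. -/

namespace SimpleGraph

variable {V : Type*} {G : SimpleGraph V}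

/-- The vertices that can be reached from `A` by walks whose vertices after the first lie in `U`. -/
inductive ReachIn (G : SimpleGraph V) (A U : Set V) : V → Prop
  | base {v : V} : v ∈ A → ReachIn G A U v
  | step {w u : V} : ReachIn G A U w → G.Adj w u → u ∈ U → ReachIn G A U u

/-- The neighbours of `b` that are neighbours neither of `b'` nor of `b''`. -/
def privateNbrs (G : SimpleGraph V) (b b' b'' : V) : Set V :=
  {v | G.Adj b v ∧ ¬ G.Adj b' v ∧ ¬ G.Adj b'' v}

/-- The vertices without neighbours among `b, b', b''`. -/
def farVerts (G : SimpleGraph V) (b b' b'' : V) : Set V :=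
  {v | ¬ G.Adj b v ∧ ¬ G.Adj b' v ∧ ¬ G.Adj b'' v}

/-- The triangle `b₁ b₂ b₃` has a private neighbour `c` of `b₁` that is linked, through vertices
far from the triangle, to private neighbours of `b₂` and of `b₃`. -/
def IsLinkedTriangle (G : SimpleGraph V) (b₁ b₂ b₃ : V) : Prop :=
  G.Adj b₁ b₂ ∧ G.Adj b₁ b₃ ∧ G.Adj b₂ b₃ ∧ ∃ c ∈ G.privateNbrs b₁ b₂ b₃,
    (∃ w, G.Adj c w ∧ G.ReachIn (G.privateNbrs b₂ b₁ b₃) (G.farVerts b₁ b₂ b₃) w) ∧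
    (∃ w, G.Adj c w ∧ G.ReachIn (G.privateNbrs b₃ b₁ b₂) (G.farVerts b₁ b₂ b₃) w)

theorem ReachIn.map {W : Type*} {F : SimpleGraph W} (φ : F ↪g G) {A U : Set W} {A' U' : Set V}
    (hA : ∀ v ∈ A, φ v ∈ A') (hU : ∀ v ∈ U, φ v ∈ U') {v : W} (h : F.ReachIn A U v) :
    G.ReachIn A' U' (φ v) := by
  induction h with
  | base h => exact .base (hA _ h)
  | step _ ha hu ih => exact .step ih (φ.map_adj_iff.2 ha) (hU _ hu)

theorem IsLinkedTriangle.map {W : Type*} {F : SimpleGraph W} (φ : F ↪g G) {b₁ b₂ b₃ : W}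
    (h : F.IsLinkedTriangle b₁ b₂ b₃) : G.IsLinkedTriangle (φ b₁) (φ b₂) (φ b₃) := by
  obtain ⟨h12, h13, h23, c, hc, ⟨w, hw, hwr⟩, w', hw', hwr'⟩ := h
  have hp : ∀ {x y z v : W}, v ∈ F.privateNbrs x y z → φ v ∈ G.privateNbrs (φ x) (φ y) (φ z) := by
    intro x y z v h
    simpa only [privateNbrs, Set.mem_ofPred_eq, φ.map_adj_iff] using h
  have hf : ∀ v ∈ F.farVerts b₁ b₂ b₃, φ v ∈ G.farVerts (φ b₁) (φ b₂) (φ b₃) := by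
    intro v h
    simpa only [farVerts, Set.mem_ofPred_eq, φ.map_adj_iff] using h
  exact ⟨φ.map_adj_iff.2 h12, φ.map_adj_iff.2 h13, φ.map_adj_iff.2 h23, φ c, hp hc,
    ⟨φ w, φ.map_adj_iff.2 hw, hwr.map φ (fun _ => hp) hf⟩,
    ⟨φ w', φ.map_adj_iff.2 hw', hwr'.map φ (fun _ => hp) hf⟩⟩

/-- A vertex that is reached is the last vertex of a walk. -/
theorem ReachIn.exists_walk {A U : Set V} {v : V} (h : G.ReachIn A U v) :
    ∃ (k : ℕ) (f : ℕ → V), f 0 ∈ A ∧ (∀ i, 1 ≤ i → i ≤ k → f i ∈ U) ∧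
      (∀ i < k, G.Adj (f i) (f (i + 1))) ∧ f k = v := by
  classical
  induction h with
  | base h => exact ⟨0, fun _ => _, h, by intros; omega, by intros; omega, rfl⟩
  | @step w u _ ha hu ih =>
    obtain ⟨k, f, h0, hU, hadj, rfl⟩ := ih
    refine ⟨k + 1, fun i => if i ≤ k then f i else u, by simpa using h0, ?_, ?_, by simp⟩
    · intro i hi hik
      by_cases h : i ≤ k
      · simpa [h] using hU i hi h
      · simpa [h] using hu
    · intro i hi
      rcases (show i < k ∨ i = k by omega) with h | rfl
      · simpa [show i ≤ k by omega, show i + 1 ≤ k by omega] using hadj i h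
      · simpa using ha

/-- A shortest walk to a target set is an induced path that meets the target only at its end. -/
theorem ReachIn.exists_isInducedPath {A U T : Set V} {v : V} (h : G.ReachIn A U v) (hv : v ∈ T) :
    ∃ (k : ℕ) (f : ℕ → V), f 0 ∈ A ∧ (∀ i, 1 ≤ i → i ≤ k → f i ∈ U) ∧
      G.IsInducedPath f k ∧ f k ∈ T ∧ ∀ i < k, f i ∉ T := by
  classical
  let W : ℕ → Prop := fun k => ∃ f : ℕ → V, f 0 ∈ A ∧ (∀ i, 1 ≤ i → i ≤ k → f i ∈ U) ∧
      (∀ i < k, G.Adj (f i) (f (i + 1))) ∧ f k ∈ T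
  have hW : ∃ k, W k := by
    obtain ⟨k, f, h1, h2, h3, rfl⟩ := h.exists_walk
    exact ⟨k, f, h1, h2, h3, hv⟩
  obtain ⟨f, h0, hU, hadj, hT⟩ := Nat.find_spec hW
  have hmin : ∀ m < Nat.find hW, ¬ W m := fun m hm => Nat.find_min hW hm
  generalize Nat.find hW = k at *
  -- A chord would let the walk skip the `d` vertices after `f i`. The first vertex is kept, so the
  -- shorter walk still starts in `A`.
  have skip : ∀ i d, 0 < d → i + 1 + d ≤ k → ¬ G.Adj (f i) (f (i + 1 + d)) := by
    intro i d hd hk ha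
    refine hmin (k - d) (by omega) ⟨fun t => if t ≤ i then f t else f (t + d), ?_, ?_, ?_, ?_⟩
    · simpa using h0
    · intro t ht htk
      dsimp only
      split_ifs
      · exact hU t ht (by omega)
      · exact hU _ (by omega) (by omega)
    · intro t ht
      rcases lt_trichotomy t i with h | rfl | h
      · simpa [show t ≤ i by omega, show t + 1 ≤ i by omega] using hadj t (by omega)
      · simpa using ha
      · simpa [show ¬ t ≤ i by omega, show ¬ t + 1 ≤ i by omega, add_right_comm]
          using hadj (t + d) (by omega)
    · simpa [show ¬ k - d ≤ i by omega, show k - d + d = k by omega] using hT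
  -- A repetition of the last vertex means that the target was met before; any other repetition
  -- gives a chord to the next vertex.
  have shortcut : ∀ i d, 0 < d → i + d ≤ k → f i ≠ f (i + d) := by
    intro i d hd hk he
    rcases (show i + d = k ∨ i + d < k by omega) with h | h
    · refine hmin i (by omega) ⟨f, h0, fun t ht ht' => hU t ht (by omega),
        fun t ht => hadj t (by omega), ?_⟩
      rw [he, h]
      exact hT
    · refine skip i d hd (by omega) ?_
      rw [he, add_right_comm]
      exact hadj _ h
  refine ⟨k, f, h0, hU, ⟨?_, ?_⟩, hT, ?_⟩
  · intro x hx y hy hxy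
    rcases lt_trichotomy x y with h | h | h
    · obtain ⟨d, rfl⟩ := Nat.exists_eq_add_of_lt h
      exact absurd hxy (shortcut x (d + 1) (by omega) (by omega))
    · exact h
    · obtain ⟨d, rfl⟩ := Nat.exists_eq_add_of_lt h
      exact absurd hxy.symm (shortcut y (d + 1) (by omega) (by omega))
  · have key : ∀ x y, x < y → y ≤ k → (G.Adj (f x) (f y) ↔ x + 1 = y) := by
      intro x y hxy hy
      refine ⟨fun ha => ?_, ?_⟩
      · by_contra hne
        obtain ⟨d, rfl⟩ := Nat.exists_eq_add_of_lt hxy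
        exact skip x d (by omega) (by omega) (by rwa [add_right_comm])
      · rintro rfl
        exact hadj x (by omega)
    intro x hx y hy
    rcases lt_trichotomy x y with h | rfl | h
    · rw [key x y h hy]
      omega
    · simp
    · rw [G.adj_comm, key y x h hx]
      omega
  · intro i hi hiT
    exact hmin i hi ⟨f, h0, fun t ht ht' => hU t ht (by omega), fun t ht => hadj t (by omega), hiT⟩

/-- The hole is `b₂, f 0, …, f k, c, b₁`, where `f` is a shortest link from `b₂` to a neighbour of
`c`; `b₃` sees exactly `b₂` and `b₁` on it. The attached path is `b₃, q 0, …, q l`, where `q` is a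
shortest link from `b₃` to a vertex with a neighbour on the hole other than `b₁` and `b₂`. Such a
link exists because `c` itself is on the hole. -/
theorem IsLinkedTriangle.containsPrism_or_containsPyramid {b₁ b₂ b₃ : V}
    (H : G.IsLinkedTriangle b₁ b₂ b₃) : G.ContainsPrism ∨ G.ContainsPyramid := by
  classical
  obtain ⟨h12, h13, h23, c, ⟨hc1, hc2, hc3⟩, ⟨w, hw, hwr⟩, w', hw', hwr'⟩ := H
  obtain ⟨k, f, hf0, hfU, hf, hfk, hfT⟩ :=
    hwr.exists_isInducedPath (T := {v | G.Adj c v}) hw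
  simp only [Set.mem_ofPred_eq] at hfk hfT
  -- the hole
  let h : ℕ → V := fun x =>
    if x = 0 then b₂ else if x ≤ k + 1 then f (x - 1) else if x = k + 2 then c else b₁
  have hh0 : h 0 = b₂ := rfl
  have hhf : ∀ x ≤ k, h (x + 1) = f x := by intro x hx; simp [h, hx]
  have hhc : h (k + 2) = c := by simp [h]
  have hhl : h (k + 3) = b₁ := by simp [h]
  have hcases : ∀ x ≤ k + 3, x = 0 ∨ (∃ y ≤ k, x = y + 1) ∨ x = k + 2 ∨ x = k + 3 := by
    intro x hx
    by_cases h0 : x = 0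
    · exact Or.inl h0
    by_cases h1 : x ≤ k + 1
    · exact Or.inr (Or.inl ⟨x - 1, by omega, by omega⟩)
    · omega
  have hb2f : ∀ y ≤ k, (G.Adj b₂ (f y) ↔ y = 0) := by
    intro y hy
    rcases Nat.eq_zero_or_pos y with rfl | hy0
    · simpa using hf0.1
    · simpa [show y ≠ 0 by omega] using (hfU y hy0 hy).2.1
  have hb1f : ∀ y ≤ k, ¬ G.Adj b₁ (f y) := by
    intro y hy
    rcases Nat.eq_zero_or_pos y with rfl | hy0
    · exact hf0.2.1
    · exact (hfU y hy0 hy).1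
  have hb3f : ∀ y ≤ k, ¬ G.Adj b₃ (f y) := by
    intro y hy
    rcases Nat.eq_zero_or_pos y with rfl | hy0
    · exact hf0.2.2
    · exact (hfU y hy0 hy).2.2
  have hcf : ∀ y ≤ k, (G.Adj c (f y) ↔ y = k) := by
    intro y hy
    refine ⟨fun ha => ?_, ?_⟩
    · by_contra hne
      exact hfT y (by omega) ha
    · rintro rfl
      exact hfk
  have hadjlt : ∀ x y, x < y → y ≤ k + 3 →
      (G.Adj (h x) (h y) ↔ x + 1 = y ∨ (x = 0 ∧ y = k + 3)) := by
    intro x y hxy hy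
    rcases hcases x (by omega) with rfl | ⟨x, hx, rfl⟩ | rfl | rfl <;>
      rcases hcases y (by omega) with rfl | ⟨y, hy', rfl⟩ | rfl | rfl <;> try omega
    · rw [hh0, hhf y hy', hb2f y hy']; omega
    · rw [hh0, hhc]; simp [hc2]
    · rw [hh0, hhl]; simp [h12.symm]
    · rw [hhf x hx, hhf y hy', hf.adj x hx y hy']; omega
    · rw [hhf x hx, hhc, G.adj_comm, hcf x hx]; omega
    · rw [hhf x hx, hhl, G.adj_comm]; simp only [hb1f x hx, false_iff]; omega
    · rw [hhc, hhl]; simp [hc1.symm]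
  have hinjlt : ∀ x y, x < y → y ≤ k + 3 → h x ≠ h y := by
    intro x y hxy hy he
    rcases hcases x (by omega) with rfl | ⟨x, hx, rfl⟩ | rfl | rfl <;>
      rcases hcases y (by omega) with rfl | ⟨y, hy', rfl⟩ | rfl | rfl <;> try omega
    · rw [hh0, hhf y hy'] at he; exact hb1f y hy' (he ▸ h12)
    · rw [hh0, hhc] at he; exact hc3 (he ▸ h23.symm)
    · rw [hh0, hhl] at he; exact h12.ne he.symm
    · rw [hhf x hx, hhf y hy'] at he
      have := hf.inj x hx y hy' he
      omega
    · rw [hhf x hx, hhc] at he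
      exact hb1f x hx (he ▸ hc1)
    · rw [hhf x hx, hhl] at he
      exact hb3f x hx (he ▸ h13.symm)
    · rw [hhc, hhl] at he
      exact G.irrefl (he ▸ hc1)
  have hadj : ∀ x ≤ k + 3, ∀ y ≤ k + 3, (G.Adj (h x) (h y) ↔
      x + 1 = y ∨ y + 1 = x ∨ (x = 0 ∧ y = k + 3) ∨ (x = k + 3 ∧ y = 0)) := by
    intro x hx y hy
    rcases lt_trichotomy x y with hl | rfl | hl
    · rw [hadjlt x y hl hy]; omega
    · simp only [SimpleGraph.irrefl, false_iff]; omega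
    · rw [G.adj_comm, hadjlt y x hl hx]; omega
  -- the path
  let T : Set V := {v | ∃ x, 0 < x ∧ x < k + 3 ∧ G.Adj (h x) v}
  obtain ⟨l, q, hq0, hqU, hq, hqT, hqnT⟩ := hwr'.exists_isInducedPath (T := T)
    ⟨k + 2, by omega, by omega, by rw [hhc]; exact hw'⟩
  have hb1q : ∀ y ≤ l, ¬ G.Adj b₁ (q y) := by
    intro y hy
    rcases Nat.eq_zero_or_pos y with rfl | hy0
    · exact hq0.2.1
    · exact (hqU y hy0 hy).1
  have hb2q : ∀ y ≤ l, ¬ G.Adj b₂ (q y) := by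
    intro y hy
    rcases Nat.eq_zero_or_pos y with rfl | hy0
    · exact hq0.2.2
    · exact (hqU y hy0 hy).2.1
  have hb3q : ∀ y ≤ l, (G.Adj b₃ (q y) ↔ y = 0) := by
    intro y hy
    rcases Nat.eq_zero_or_pos y with rfl | hy0
    · simpa using hq0.1
    · simpa [show y ≠ 0 by omega] using (hqU y hy0 hy).2.2
  have hb3h : ∀ x ≤ k + 3, (G.Adj b₃ (h x) ↔ x = 0 ∨ x = k + 3) := by
    intro x hx
    rcases hcases x hx with rfl | ⟨x, hx', rfl⟩ | rfl | rfl
    · simp [hh0, h23.symm]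
    · rw [hhf x hx']; simp only [hb3f x hx', false_iff]; omega
    · rw [hhc]; simp [hc3]
    · rw [hhl]; simp [h13.symm]
  have hqh : ∀ y < l, ∀ x ≤ k + 3, ¬ G.Adj (h x) (q y) := by
    intro y hy x hx ha
    rcases (show x = 0 ∨ x = k + 3 ∨ (0 < x ∧ x < k + 3) by omega) with rfl | rfl | hx'
    · exact hb2q y hy.le ha
    · rw [hhl] at ha
      exact hb1q y hy.le ha
    · exact hqnT y hy ⟨x, hx'.1, hx'.2, ha⟩
  -- If `q y` were on the hole with `y > 0`, its predecessor would already see the hole. If `q 0`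
  -- were on it, it would be `b₁` or `b₂`, being adjacent to `b₃`; but these are adjacent to each
  -- other, and `q 0` sees neither.
  have hqne : ∀ y ≤ l, ∀ x ≤ k + 3, h x ≠ q y := by
    intro y hy x hx he
    rcases Nat.eq_zero_or_pos y with rfl | hy0
    · have := (hb3h x hx).1 (he ▸ hq0.1)
      rcases this with rfl | rfl
      · rw [hh0] at he
        exact hq0.2.1 (he ▸ h12)
      · rw [hhl] at he
        exact hq0.2.2 (he ▸ h12.symm)
    · have ha : G.Adj (q (y - 1)) (q y) := (hq.adj _ (by omega) _ hy).2 (by omega)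
      exact hqh (y - 1) (by omega) x hx (he ▸ ha.symm)
  have hb3ne : ∀ x ≤ k + 3, h x ≠ b₃ := by
    intro x hx he
    have h1 : G.Adj (h x) (h 0) := by rw [he, hh0]; exact h23.symm
    have h2 : G.Adj (h x) (h (k + 3)) := by rw [he, hhl]; exact h13.symm
    rw [hadj x hx _ (by omega)] at h1 h2
    omega
  have hb3nq : ∀ y ≤ l, q y ≠ b₃ := fun y hy he => hb2q y hy (he ▸ h23)
  let g : ℕ → V := fun y => if y = 0 then b₃ else q (y - 1)
  have hg0 : g 0 = b₃ := rfl
  have hgs : ∀ y, g (y + 1) = q y := fun y => rfl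
  refine IsHoleWithPath.containsPrism_or_containsPyramid (h := h) (L := k + 3) (g := g)
    (M := l + 1) ⟨by omega, by omega, ?_, hadj, ⟨?_, ?_⟩, ?_, ?_, hqT, ?_, ?_⟩
  · intro x hx y hy he
    rcases lt_trichotomy x y with hl | hl | hl
    · exact absurd he (hinjlt x y hl hy)
    · exact hl
    · exact absurd he.symm (hinjlt y x hl hx)
  · rintro (_ | x) hx (_ | y) hy he
    · rfl
    · exact absurd he.symm (hb3nq y (by omega))
    · exact absurd he (hb3nq x (by omega))
    · rw [hq.inj x (by omega) y (by omega) he]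
  · rintro (_ | x) hx (_ | y) hy
    · simp
    · rw [hg0, hgs, hb3q y (by omega)]; omega
    · rw [hg0, hgs, G.adj_comm, hb3q x (by omega)]; omega
    · rw [hgs, hgs, hq.adj x (by omega) y (by omega)]; omega
  · rintro x hx (_ | y) hy
    · exact hb3ne x hx
    · exact hqne y (by omega) x hx
  · rintro x hx (_ | y) hy
    · rw [hg0, G.adj_comm, hb3h x hx]; simp
    · rw [hgs]
      simp [hqh y (by omega) x hx]
  · rw [hgs]; exact hb2q l le_rfl
  · rw [hgs, hhl]; exact hb1q l le_rfl

/-! ### Prisms and pyramids contain linked triangles. -/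

theorem ReachIn.of_path_downward {A U : Set V} {p : ℕ → V} {k s : ℕ} (hp : G.IsInducedPath p k)
    (hA : p (k - 1) ∈ A) (hs : s + 1 ≤ k) (hU : ∀ x, s ≤ x → x + 2 ≤ k → p x ∈ U) :
    G.ReachIn A U (p s) := by
  have : ∀ t, t + s + 1 ≤ k → G.ReachIn A U (p (k - 1 - t)) := by
    intro t
    induction t with
    | zero => intro _; exact .base hA
    | succ t ih =>
      intro ht
      refine .step (ih (by omega)) ?_ (hU _ (by omega) (by omega))
      rw [hp.adj _ (by omega) _ (by omega)]
      omega
  have := this (k - 1 - s) (by omega)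
  rwa [show k - 1 - (k - 1 - s) = s by omega] at this

/-- Climbs the path that leads to `c = p (k - 1)`, starting from a reached neighbour of `p 0`. For
`k = 1` the vertex `c` is `p 0` and nothing has to be climbed. -/
theorem ReachIn.exists_adj_of_path {A U : Set V} {p : ℕ → V} {k : ℕ} {w : V}
    (hp : G.IsInducedPath p k) (hk : 1 ≤ k) (hw : G.ReachIn A U w) (ha : G.Adj (p 0) w)
    (hU : ∀ x, x + 2 ≤ k → p x ∈ U) : ∃ w, G.Adj (p (k - 1)) w ∧ G.ReachIn A U w := by
  rcases hk.eq_or_lt with rfl | hk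
  · exact ⟨w, ha, hw⟩
  · have : ∀ x, x + 2 ≤ k → G.ReachIn A U (p x) := by
      intro x
      induction x with
      | zero => intro h; exact .step hw ha.symm (hU 0 h)
      | succ x ih =>
        intro h
        exact .step (ih (by omega)) ((hp.adj _ (by omega) _ (by omega)).2 (by omega)) (hU _ h)
    exact ⟨p (k - 2), (hp.adj _ (by omega) _ (by omega)).2 (by omega), this _ (by omega)⟩

/-- On each path the vertex before `bᵢ` is a private neighbour of `bᵢ`, and all earlier ones are
far. The links run down a path to its end `aⱼ`, across the other triangle, and up the path of index
`0`. -/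
theorem IsPrism.exists_isLinkedTriangle (h : G.IsPrism) :
    ∃ b₁ b₂ b₃, G.IsLinkedTriangle b₁ b₂ b₃ := by
  obtain ⟨k, P, hk, hpart, ha, hb, hcross⟩ := h
  choose p hp hPp hpP using fun i => exists_isInducedPath (P i)
  have hcr : ∀ i j, i ≠ j → ∀ x < k i, ∀ y ≤ k j, 0 < y → ¬ G.Adj (p j y) (p i x) := by
    intro i j hij x hx y hy hy0 hadj
    rw [hpP j y hy, hpP i x hx.le] at hadj
    have := hcross j i hij.symm _ _ hadj
    simp only [Fin.ext_iff, Fin.val_zero, Fin.val_last] at this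
    omega
  have hb' : ∀ i j, i ≠ j → G.Adj (p i (k i)) (p j (k j)) := by
    intro i j hij
    rw [hpP i _ le_rfl, hpP j _ le_rfl]
    exact hb i j hij
  have ha' : ∀ i j, i ≠ j → G.Adj (p i 0) (p j 0) := by
    intro i j hij
    rw [hpP i _ (by omega), hpP j _ (by omega)]
    exact ha i j hij
  have hA : ∀ i j l, i ≠ j → i ≠ l →
      p i (k i - 1) ∈ G.privateNbrs (p i (k i)) (p j (k j)) (p l (k l)) := by
    intro i j l hij hil
    have := hk i
    refine ⟨((hp i).adj _ le_rfl _ (by omega)).2 (by omega), ?_, ?_⟩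
    · exact hcr i j hij _ (by omega) _ le_rfl (hk j)
    · exact hcr i l hil _ (by omega) _ le_rfl (hk l)
  have hU : ∀ i x, x + 2 ≤ k i →
      p i x ∈ G.farVerts (p 0 (k 0)) (p 1 (k 1)) (p 2 (k 2)) := by
    intro i x hx
    have key : ∀ j, ¬ G.Adj (p j (k j)) (p i x) := by
      intro j
      by_cases hij : i = j
      · subst hij
        rw [(hp i).adj _ le_rfl _ (by omega)]
        omega
      · exact hcr i j hij x (by omega) _ le_rfl (hk j)
    exact ⟨key 0, key 1, key 2⟩
  have reach : ∀ j A, j ≠ 0 → p j (k j - 1) ∈ A → ∃ w, G.Adj (p 0 (k 0 - 1)) w ∧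
      G.ReachIn A (G.farVerts (p 0 (k 0)) (p 1 (k 1)) (p 2 (k 2))) w := by
    intro j A hj hA
    exact ReachIn.exists_adj_of_path (hp 0) (hk 0)
      (ReachIn.of_path_downward (s := 0) (hp j) hA (hk j) fun x _ hx => hU j x hx)
      (ha' 0 j hj.symm) (hU 0)
  exact ⟨p 0 (k 0), p 1 (k 1), p 2 (k 2), hb' 0 1 (by decide), hb' 0 2 (by decide),
    hb' 1 2 (by decide), p 0 (k 0 - 1), hA 0 1 2 (by decide) (by decide),
    reach 1 _ (by decide) (hA 1 0 2 (by decide) (by decide)),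
    reach 2 _ (by decide) (hA 2 0 1 (by decide) (by decide))⟩

/-- The links pass through the apex. If the path of `i₁` has length one, then `c` is the apex,
adjacent to `b` of `i₁` only; otherwise the apex is far. This is why the other two paths must have
length at least two. -/
theorem IsPyramid.exists_isLinkedTriangle (h : G.IsPyramid) :
    ∃ b₁ b₂ b₃, G.IsLinkedTriangle b₁ b₂ b₃ := by
  obtain ⟨a, k, P, hk, ha, hcover, hmeet, hb, hcross, hone⟩ := h
  obtain ⟨i₁, i₂, i₃, h12, h13, h23, hk2, hk3⟩ : ∃ i₁ i₂ i₃ : Fin 3, i₁ ≠ i₂ ∧ i₁ ≠ i₃ ∧ i₂ ≠ i₃ ∧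
      2 ≤ k i₂ ∧ 2 ≤ k i₃ := by
    have h01 := hone 0 1
    have h02 := hone 0 2
    have h12 := hone 1 2
    have := hk 0
    have := hk 1
    have := hk 2
    simp at h01 h02 h12
    by_cases h0 : k 0 = 1
    · exact ⟨0, 1, 2, by decide, by decide, by decide, by omega, by omega⟩
    by_cases h1 : k 1 = 1
    · exact ⟨1, 0, 2, by decide, by decide, by decide, by omega, by omega⟩
    · exact ⟨2, 0, 1, by decide, by decide, by decide, by omega, by omega⟩
  choose p hp hPp hpP using fun i => exists_isInducedPath (P i)
  have ha' : ∀ i, p i 0 = a := by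
    intro i
    rw [hpP i _ (by omega)]
    exact ha i
  have hnea : ∀ i x, x ≤ k i → 0 < x → p i x ≠ a := by
    intro i x hx hx0 he
    have := (hp i).inj x hx 0 (by omega) (by rw [he, ha'])
    omega
  have hcr : ∀ i j, i ≠ j → ∀ x < k i, ∀ y ≤ k j, 0 < x → 0 < y → ¬ G.Adj (p j y) (p i x) := by
    intro i j hij x hx y hy hx0 hy0 hadj
    have hi := hnea i x hx.le hx0
    have hj := hnea j y hy hy0
    rw [hpP i x hx.le] at hi
    rw [hpP j y hy] at hj
    rw [hpP j y hy, hpP i x hx.le] at hadj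
    rcases hcross j i hij.symm _ _ hadj with (h | h) | ⟨-, h⟩
    · exact hj h
    · exact hi h
    · exact absurd (congrArg Fin.val h) hx.ne
  have hb' : ∀ i j, i ≠ j → G.Adj (p i (k i)) (p j (k j)) := by
    intro i j hij
    rw [hpP i _ le_rfl, hpP j _ le_rfl]
    exact hb i j hij
  have hab : ∀ j, 2 ≤ k j → ¬ G.Adj (p j (k j)) a := by
    intro j hj
    rw [← ha' j, (hp j).adj _ le_rfl _ (by omega)]
    omega
  have hA : ∀ i j l, i ≠ j → i ≠ l → (k i = 1 → 2 ≤ k j ∧ 2 ≤ k l) →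
      p i (k i - 1) ∈ G.privateNbrs (p i (k i)) (p j (k j)) (p l (k l)) := by
    intro i j l hij hil h1
    have hki := hk i
    have key : ∀ m, i ≠ m → (k i = 1 → 2 ≤ k m) → ¬ G.Adj (p m (k m)) (p i (k i - 1)) := by
      intro m hm h1m
      by_cases h : k i = 1
      · rw [h, ha']
        exact hab m (h1m h)
      · exact hcr i m hm _ (by omega) _ le_rfl (by omega) (hk m)
    exact ⟨((hp i).adj _ le_rfl _ (by omega)).2 (by omega), key j hij fun h => (h1 h).1,
      key l hil fun h => (h1 h).2⟩
  have hnear : ∀ i x, x + 2 ≤ k i → 0 < x → ∀ j, ¬ G.Adj (p j (k j)) (p i x) := by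
    intro i x hx hx0 j
    by_cases hij : i = j
    · subst hij
      rw [(hp i).adj _ le_rfl _ (by omega)]
      omega
    · exact hcr i j hij x (by omega) _ le_rfl hx0 (hk j)
  have hU : ∀ i x, x + 2 ≤ k i → 0 < x →
      p i x ∈ G.farVerts (p i₁ (k i₁)) (p i₂ (k i₂)) (p i₃ (k i₃)) := by
    intro i x hx hx0
    exact ⟨hnear i x hx hx0 i₁, hnear i x hx hx0 i₂, hnear i x hx hx0 i₃⟩
  have reach : ∀ j A, 2 ≤ k j → p j (k j - 1) ∈ A → ∃ w, G.Adj (p i₁ (k i₁ - 1)) w ∧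
      G.ReachIn A (G.farVerts (p i₁ (k i₁)) (p i₂ (k i₂)) (p i₃ (k i₃))) w := by
    intro j A hj hA
    refine ReachIn.exists_adj_of_path (hp i₁) (hk i₁)
      (ReachIn.of_path_downward (s := 1) (hp j) hA (by omega) fun x hx1 hx => hU j x hx hx1)
      ?_ ?_
    · rw [ha' i₁, ← ha' j, (hp j).adj _ (by omega) _ (by omega)]
      omega
    · intro x hx
      rcases Nat.eq_zero_or_pos x with rfl | hx0
      · rw [ha']
        exact ⟨hab i₁ (by omega), hab i₂ hk2, hab i₃ hk3⟩
      · exact hU i₁ x hx hx0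
  exact ⟨p i₁ (k i₁), p i₂ (k i₂), p i₃ (k i₃), hb' _ _ h12, hb' _ _ h13, hb' _ _ h23,
    p i₁ (k i₁ - 1), hA _ _ _ h12 h13 fun _ => ⟨hk2, hk3⟩,
    reach i₂ _ hk2 (hA _ _ _ h12.symm h23 (by omega)),
    reach i₃ _ hk3 (hA _ _ _ h13.symm h23.symm (by omega))⟩

theorem containsPrism_or_containsPyramid_iff :
    G.ContainsPrism ∨ G.ContainsPyramid ↔ ∃ b₁ b₂ b₃, G.IsLinkedTriangle b₁ b₂ b₃ := by
  constructor
  · rintro (⟨S, hS⟩ | ⟨S, hS⟩)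
    · obtain ⟨b₁, b₂, b₃, h⟩ := hS.exists_isLinkedTriangle
      exact ⟨_, _, _, h.map (Embedding.induce S)⟩
    · obtain ⟨b₁, b₂, b₃, h⟩ := hS.exists_isLinkedTriangle
      exact ⟨_, _, _, h.map (Embedding.induce S)⟩
  · rintro ⟨b₁, b₂, b₃, h⟩
    exact h.containsPrism_or_containsPyramid

/-! ### Berge graphs contain no pyramid. -/

/-- Two paths of a pyramid whose lengths have the same parity form an odd hole. -/
theorem IsBerge.not_containsPyramid (hG : G.IsBerge) : ¬ G.ContainsPyramid := by
  rintro ⟨S, a, k, P, hk, ha, hcover, hmeet, hb, hcross, hone⟩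
  obtain ⟨i, j, hij, hpar⟩ : ∃ i j : Fin 3, i ≠ j ∧ Even (k i + k j) := by
    by_cases h01 : Even (k 0 + k 1)
    · exact ⟨0, 1, by decide, h01⟩
    by_cases h02 : Even (k 0 + k 2)
    · exact ⟨0, 2, by decide, h02⟩
    · refine ⟨1, 2, by decide, ?_⟩
      rw [Nat.not_even_iff] at h01 h02
      rw [Nat.even_iff]
      omega
  -- The lengths are not both one, so their sum is at least three, and it is even.
  have h4 : 4 ≤ k i + k j := by
    have h1 := hk i
    have h2 := hk j
    have h3 : ¬ (k i = 1 ∧ k j = 1) := fun h => hij (hone i j h.1 h.2)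
    rw [Nat.even_iff] at hpar
    omega
  choose p hp hPp hpP using fun i => exists_isInducedPath (P i)
  have ha' : ∀ i, p i 0 = a := by
    intro i
    rw [hpP i _ (by omega)]
    exact ha i
  have hnea : ∀ i x, x ≤ k i → 0 < x → p i x ≠ a := by
    intro i x hx hx0 he
    have := (hp i).inj x hx 0 (by omega) (by rw [he, ha'])
    omega
  have hne : ∀ x ≤ k i, ∀ y ≤ k j, 0 < x → p i x ≠ p j y := by
    intro x hx y hy hx0 he
    apply hnea i x hx hx0
    rw [hpP i x hx]
    rw [hpP i x hx, hpP j y hy] at he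
    exact hmeet i j hij _ _ he
  have hadj : ∀ x ≤ k i, ∀ y ≤ k j, 0 < x → 0 < y →
      ((G.induce S).Adj (p i x) (p j y) ↔ x = k i ∧ y = k j) := by
    intro x hx y hy hx0 hy0
    constructor
    · intro h
      have h1 := hnea i x hx hx0
      have h2 := hnea j y hy hy0
      rw [hpP i x hx] at h1 h
      rw [hpP j y hy] at h2 h
      have := hcross i j hij _ _ h
      simpa only [Fin.ext_iff, Fin.val_last, h1, h2, false_or, or_self] using this
    · rintro ⟨rfl, rfl⟩
      rw [hpP i _ le_rfl, hpP j _ le_rfl]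
      exact hb i j hij
  -- The cycle runs from `b i` down to the apex, reached at index `k i`, and then up to `b j`; the
  -- triangle edge `b j b i` closes it.
  let c : ℕ → S := fun x => if x ≤ k i then p i (k i - x) else p j (x - k i)
  have hc1 : ∀ x ≤ k i, c x = p i (k i - x) := fun x hx => if_pos hx
  have hc2 : ∀ x, k i ≤ x → c x = p j (x - k i) := by
    intro x hx
    rcases hx.eq_or_lt with rfl | hx
    · rw [hc1 _ le_rfl, Nat.sub_self, ha', ha']
    · exact if_neg (by omega)
  have hclt : ∀ x y, x < y → y ≤ k i + k j → c x ≠ c y ∧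
      ((G.induce S).Adj (c x) (c y) ↔ x + 1 = y ∨ (x = 0 ∧ y = k i + k j)) := by
    intro x y hxy hy
    have := hk i
    have := hk j
    rcases (show y ≤ k i ∨ k i ≤ x ∨ (x < k i ∧ k i < y) by omega) with h | h | ⟨h, h'⟩
    · rw [hc1 x (by omega), hc1 y h]
      refine ⟨fun he => ?_, ?_⟩
      · have := (hp i).inj _ (by omega) _ (by omega) he
        omega
      · rw [(hp i).adj _ (by omega) _ (by omega)]
        omega
    · rw [hc2 x h, hc2 y (by omega)]
      refine ⟨fun he => ?_, ?_⟩
      · have := (hp j).inj _ (by omega) _ (by omega) he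
        omega
      · rw [(hp j).adj _ (by omega) _ (by omega)]
        omega
    · rw [hc1 x h.le, hc2 y h'.le]
      refine ⟨hne _ (by omega) _ (by omega) (by omega), ?_⟩
      rw [hadj _ (by omega) _ (by omega) (by omega) (by omega)]
      omega
  have hcadj : ∀ x ≤ k i + k j, ∀ y ≤ k i + k j, ((G.induce S).Adj (c x) (c y) ↔
      x + 1 = y ∨ y + 1 = x ∨ (x = 0 ∧ y = k i + k j) ∨ (x = k i + k j ∧ y = 0)) := by
    intro x hx y hy
    rcases lt_trichotomy x y with h | rfl | h
    · rw [(hclt x y h hy).2]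
      omega
    · simp only [SimpleGraph.irrefl, false_iff]
      omega
    · rw [SimpleGraph.adj_comm, (hclt y x h hx).2]
      omega
  let φ : cycleGraph (k i + k j + 1) ↪g G.induce S :=
    { toFun := fun x => c x
      inj' := by
        intro x y he
        apply Fin.ext
        rcases lt_trichotomy (x : ℕ) y with h | h | h
        · exact absurd he (hclt _ _ h (by omega)).1
        · exact h
        · exact absurd he.symm (hclt _ _ h (by omega)).1
      map_rel_iff' := by
        intro x y
        change (G.induce S).Adj (c x) (c y) ↔ _
        rw [hcadj x (by omega) y (by omega), cycleGraph_adj']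
        have hx := x.isLt
        have hy := y.isLt
        have key : ∀ u v : Fin (k i + k j + 1), (u - v).val = 1 ↔
            v.val + 1 = u.val ∨ (u.val = 0 ∧ v.val = k i + k j) := by
          intro u v
          rw [Fin.sub_def]
          simp only
          rcases le_or_gt v.val u.val with h | h
          · rw [show k i + k j + 1 - v.val + u.val = (u.val - v.val) + (k i + k j + 1) by omega,
              Nat.add_mod_right, Nat.mod_eq_of_lt (by omega)]
            omega
          · rw [Nat.mod_eq_of_lt (by omega)]
            omega
        rw [key, key]
        omega }
  let ψ := φ.trans (Embedding.induce S)
  refine (hG (Set.range ψ)).1 ⟨k i + k j + 1, by omega, hpar.add_one, ⟨?_⟩⟩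
  exact Embedding.isoInduceRange ψ

end SimpleGraph

/-! ### Positions in the concatenated lists, and their total length. -/

namespace AdjLists

variable {n : ℕ} {G : SimpleGraph (Fin n)} (L : AdjLists G)

theorem finRange_eq_take_append (v : Fin n) : List.finRange n =
    (List.finRange n).take v ++ v :: (List.finRange n).drop (v + 1) := by
  conv_lhs => rw [← List.take_append_drop v (List.finRange n)]
  rw [List.drop_eq_getElem_cons (by simp)]
  simp

theorem start_succ (v : Fin n) : L.start (v + 1) = L.start v + (L.nbrs v).length := by
  simp only [start]
  rw [List.take_add_one]
  simp

theorem flat_getD (v : Fin n) (j : ℕ) (hj : j < (L.nbrs v).length) :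
    L.flat.getD (L.start v + j) 0 = (L.nbrs v)[j] := by
  have hlen : (((List.finRange n).take v).flatMap fun v => (L.nbrs v).map Fin.val).length =
      L.start v := by
    simp [start, List.length_flatMap]
  rw [flat, finRange_eq_take_append v, List.flatMap_append, List.flatMap_cons,
    List.getD_append_right _ _ _ _ (by rw [hlen]; omega), hlen, Nat.add_sub_cancel_left,
    List.getD_append _ _ _ _ (by simpa using hj), List.getD_eq_getElem _ _ (by simpa using hj)]
  simp

theorem sum_length_nbrs : ∑ v, (L.nbrs v).length = 2 * G.edgeSet.ncard := by
  classical
  rw [Set.ncard_eq_toFinset_card', ← SimpleGraph.edgeFinset, ← G.sum_degrees_eq_twice_card_edges]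
  refine Finset.sum_congr rfl fun v _ => ?_
  rw [← List.toFinset_card_of_nodup (L.nodup v), ← G.card_neighborFinset_eq_degree]
  congr 1
  ext w
  simp [L.mem_iff]

end AdjLists

/-! ### Reasoning about executions: step counts, loops, unchanged memory. -/

namespace RAM

@[simp] theorem State.reg_setReg (σ : State) (r v s : ℕ) :
    (σ.setReg r v).reg s = if s = r then v else σ.reg s := by
  simp [State.setReg, Function.update_apply]

@[simp] theorem State.arr_setReg (σ : State) (r v : ℕ) : (σ.setReg r v).arr = σ.arr := rfl

@[simp] theorem State.reg_setArr (σ : State) (a i v : ℕ) : (σ.setArr a i v).reg = σ.reg := rfl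

@[simp] theorem State.arr_setArr (σ : State) (a i v b j : ℕ) :
    (σ.setArr a i v).arr b j = if b = a ∧ j = i then v else σ.arr b j := by
  simp only [State.setArr, Function.update_apply]
  split_ifs <;> simp_all

/-- The program `p`, started in `σ`, halts after some number `t` of steps in a memory `τ` such that
`Q t τ`. -/
def Runs (p : Prog) (σ : State) (Q : ℕ → State → Prop) : Prop :=
  ∃ t τ, Exec p σ t τ ∧ Q t τ

theorem Runs.mono {p : Prog} {σ : State} {Q R : ℕ → State → Prop} (h : Runs p σ Q)
    (hQR : ∀ t τ, Q t τ → R t τ) : Runs p σ R := by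
  obtain ⟨t, τ, h, hQ⟩ := h
  exact ⟨t, τ, h, hQR t τ hQ⟩

/-- This rule and the next three are equivalences, so that rewriting with them reduces a loop-free
program to conditions on its final memory and step count. -/
theorem runs_skip {σ : State} {Q : ℕ → State → Prop} : Runs .skip σ Q ↔ Q 1 σ := by
  constructor
  · rintro ⟨t, τ, h, hQ⟩
    cases h
    exact hQ
  · exact fun h => ⟨1, σ, .skip σ, h⟩

theorem runs_op {o : Op} {σ : State} {Q : ℕ → State → Prop} :
    Runs (.op o) σ Q ↔ Q 1 (o.apply σ) := by
  constructor
  · rintro ⟨t, τ, h, hQ⟩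
    cases h
    exact hQ
  · exact fun h => ⟨1, _, .op o σ, h⟩

theorem runs_seq {p q : Prog} {σ : State} {Q : ℕ → State → Prop} :
    Runs (.seq p q) σ Q ↔ Runs p σ fun t τ => Runs q τ fun u υ => Q (t + u) υ := by
  constructor
  · rintro ⟨t, τ, h, hQ⟩
    cases h with
    | seq h1 h2 => exact ⟨_, _, h1, _, _, h2, hQ⟩
  · rintro ⟨t, τ, h1, u, υ, h2, hQ⟩
    exact ⟨_, _, .seq h1 h2, hQ⟩

theorem runs_ite {b : Test} {p q : Prog} {σ : State} {Q : ℕ → State → Prop} :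
    Runs (.ite b p q) σ Q ↔ (b.holds σ → Runs p σ fun t τ => Q (1 + t) τ) ∧
      (¬ b.holds σ → Runs q σ fun t τ => Q (1 + t) τ) := by
  constructor
  · rintro ⟨t, τ, h, hQ⟩
    cases h with
    | ite_true hb h => exact ⟨fun _ => ⟨_, _, h, hQ⟩, fun hn => absurd hb hn⟩
    | ite_false hb h => exact ⟨fun hn => absurd hn hb, fun _ => ⟨_, _, h, hQ⟩⟩
  · rintro ⟨h1, h2⟩
    by_cases hb : b.holds σ
    · obtain ⟨t, τ, h, hQ⟩ := h1 hb
      exact ⟨_, _, .ite_true hb h, hQ⟩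
    · obtain ⟨t, τ, h, hQ⟩ := h2 hb
      exact ⟨_, _, .ite_false hb h, hQ⟩

/-- Rule for loops: `I a` is an invariant that depends on an auxiliary value `a`, and `μ a` bounds
the number of steps still to come. -/
theorem Runs.loop {α : Type*} {b : Test} {p : Prog} (I : α → State → Prop) (μ : α → ℕ)
    (hstep : ∀ a σ, I a σ → b.holds σ →
      Runs p σ fun t τ => ∃ a', I a' τ ∧ 1 + t + μ a' ≤ μ a)
    {a : α} {σ : State} (h : I a σ) :
    Runs (.loop b p) σ fun t τ => ∃ a', I a' τ ∧ ¬ b.holds τ ∧ t + μ a' ≤ μ a + 1 := by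
  -- Every turn costs at least the step of its test, so `μ` strictly decreases. The `+ 1` in the
  -- conclusion pays for the last test, which fails.
  induction hm : μ a using Nat.strong_induction_on generalizing a σ with
  | _ m ih =>
    by_cases hb : b.holds σ
    · obtain ⟨t, τ, ht, a', ha', hle⟩ := hstep a σ h hb
      obtain ⟨u, υ, hu, a'', ha'', hn, hle'⟩ := ih (μ a') (by omega) ha' rfl
      exact ⟨_, _, .loop_true hb ht hu, a'', ha'', hn, by omega⟩
    · exact ⟨_, _, .loop_false hb, a, h, hb, by omega⟩

/-- The registers that an operation may change. -/
def Op.regs : Op → List ℕ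
  | .const r _ => [r]
  | .copy r _ => [r]
  | .succ r => [r]
  | .pred r => [r]
  | .load r _ _ => [r]
  | .store _ _ _ => []

/-- The arrays that an operation may change. -/
def Op.arrs : Op → List ℕ
  | .store a _ _ => [a]
  | _ => []

/-- The registers that a program may change. -/
def Prog.regs : Prog → List ℕ
  | .skip => []
  | .op o => o.regs
  | .seq p q => p.regs ++ q.regs
  | .ite _ p q => p.regs ++ q.regs
  | .loop _ p => p.regs

/-- The arrays that a program may change. -/
def Prog.arrs : Prog → List ℕ
  | .skip => []
  | .op o => o.arrs
  | .seq p q => p.arrs ++ q.arrs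
  | .ite _ p q => p.arrs ++ q.arrs
  | .loop _ p => p.arrs

/-- The memories `σ` and `τ` agree outside the registers `rs` and the arrays `as`. -/
structure AgreeOutside (rs as : List ℕ) (σ τ : State) : Prop where
  reg : ∀ r ∉ rs, τ.reg r = σ.reg r
  arr : ∀ a ∉ as, τ.arr a = σ.arr a

namespace AgreeOutside

variable {rs rs' as as' : List ℕ} {σ τ υ : State}

theorem refl (rs as : List ℕ) (σ : State) : AgreeOutside rs as σ σ :=
  ⟨fun _ _ => rfl, fun _ _ => rfl⟩

theorem trans (h : AgreeOutside rs as σ τ) (h' : AgreeOutside rs as τ υ) :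
    AgreeOutside rs as σ υ :=
  ⟨fun r hr => (h'.reg r hr).trans (h.reg r hr), fun a ha => (h'.arr a ha).trans (h.arr a ha)⟩

theorem mono (h : AgreeOutside rs as σ τ) (hr : rs ⊆ rs') (ha : as ⊆ as') :
    AgreeOutside rs' as' σ τ :=
  ⟨fun r h' => h.reg r fun h'' => h' (hr h''), fun a h' => h.arr a fun h'' => h' (ha h'')⟩

end AgreeOutside

theorem Op.agreeOutside (o : Op) (σ : State) : AgreeOutside o.regs o.arrs σ (o.apply σ) := by
  refine ⟨fun r hr => ?_, fun a ha => ?_⟩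
  · cases o <;> simp_all [Op.regs, Op.apply]
  · cases o <;> simp_all [Op.arrs, Op.apply, State.setArr]

/-- A syntactic frame rule: the names of registers and arrays that can change are read off the
program, so preservation of everything else is mostly settled by `simp` or `decide`. -/
theorem Exec.agreeOutside {p : Prog} {σ τ : State} {t : ℕ} (h : Exec p σ t τ) :
    AgreeOutside p.regs p.arrs σ τ := by
  induction h with
  | skip σ => exact .refl _ _ _
  | op o σ => exact o.agreeOutside σ
  | seq _ _ ih1 ih2 =>
    exact (ih1.mono (by simp [Prog.regs]) (by simp [Prog.arrs])).trans
      (ih2.mono (by simp [Prog.regs]) (by simp [Prog.arrs]))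
  | ite_true _ _ ih => exact ih.mono (by simp [Prog.regs]) (by simp [Prog.arrs])
  | ite_false _ _ ih => exact ih.mono (by simp [Prog.regs]) (by simp [Prog.arrs])
  | loop_false _ => exact .refl _ _ _
  | loop_true _ _ _ ih1 ih2 => exact AgreeOutside.trans ih1 ih2

theorem Runs.agreeOutside {p : Prog} {σ : State} {Q : ℕ → State → Prop} (h : Runs p σ Q) :
    Runs p σ fun t τ => Q t τ ∧ AgreeOutside p.regs p.arrs σ τ := by
  obtain ⟨t, τ, h, hQ⟩ := h
  exact ⟨t, τ, h, hQ, h.agreeOutside⟩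

/-- The registers `0, 2, 3` and the arrays `0, 1` are left unchanged. -/
def Safe (rs as : List ℕ) : Prop :=
  0 ∉ rs ∧ 2 ∉ rs ∧ 3 ∉ rs ∧ 0 ∉ as ∧ 1 ∉ as

instance (rs as : List ℕ) : Decidable (Safe rs as) := by
  unfold Safe
  infer_instance

variable {n : ℕ} {G : SimpleGraph (Fin n)}

/-- The memory contains the adjacency lists, and the constants `0` and `1` in the registers `2`
and `3`. -/
structure HasInput (L : AdjLists G) (σ : State) : Prop where
  size : σ.reg 0 = n
  zero : σ.reg 2 = 0
  one : σ.reg 3 = 1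
  start : σ.arr 0 = L.input.arr 0
  flat : σ.arr 1 = L.input.arr 1

namespace HasInput

variable {L : AdjLists G} {σ τ : State}

theorem of_agree (h : HasInput L σ) {rs as : List ℕ} (ha : AgreeOutside rs as σ τ)
    (hs : Safe rs as) : HasInput L τ where
  size := (ha.reg _ hs.1).trans h.size
  zero := (ha.reg _ hs.2.1).trans h.zero
  one := (ha.reg _ hs.2.2.1).trans h.one
  start := (ha.arr _ hs.2.2.2.1).trans h.start
  flat := (ha.arr _ hs.2.2.2.2).trans h.flat

theorem arr_zero (h : HasInput L σ) {i : ℕ} (hi : i ≤ n) : σ.arr 0 i = L.start i := by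
  rw [h.start]
  simp [AdjLists.input, hi]

theorem arr_one (h : HasInput L σ) (v : Fin n) {j : ℕ} (hj : j < (L.nbrs v).length) :
    σ.arr 1 (L.start v + j) = (L.nbrs v)[j] := by
  rw [h.flat, ← L.flat_getD v j hj]
  simp [AdjLists.input]

end HasInput

/-! ### Loops over vertices and over adjacency lists. -/

/-- For all vertices `r` do `p`. -/
def forVerts (r : ℕ) (p : Prog) : Prog :=
  .seq (.op (.const r 0)) (.loop (.lt r 0) (.seq p (.op (.succ r))))

/-- Each turn pays `2` beyond the body, for test and increment; the final `2` is the initialisation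
and the failing test. By `hJ` the invariant ignores the loop counter, whose value is tracked
separately. -/
theorem Runs.forVerts {L : AdjLists G} {r : ℕ} {p : Prog} {σ : State} (J : ℕ → State → Prop)
    (cost : Fin n → ℕ) (hσ : HasInput L σ) (hr : r ∉ p.regs) (hsafe : Safe (r :: p.regs) p.arrs)
    (hJ : ∀ i τ x, J i τ → J i (τ.setReg r x)) (h0 : J 0 σ)
    (hp : ∀ (v : Fin n) (τ : State), HasInput L τ → AgreeOutside (r :: p.regs) p.arrs σ τ →
      J v τ → τ.reg r = v → Runs p τ fun t υ => t ≤ cost v ∧ J (v + 1) υ) :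
    Runs (forVerts r p) σ fun t τ =>
      t ≤ ∑ v, (cost v + 2) + 2 ∧ J n τ ∧ AgreeOutside (r :: p.regs) p.arrs σ τ := by
  let c : ℕ → ℕ := fun i => if h : i < n then cost ⟨i, h⟩ + 2 else 0
  have hr0 : 0 ≠ r := fun h => hsafe.1 (by simp [h])
  have key := Runs.loop (b := .lt r 0) (p := .seq p (.op (.succ r)))
    (fun i τ => τ.reg r = i ∧ i ≤ n ∧ J i τ ∧ AgreeOutside (r :: p.regs) p.arrs σ τ)
    (fun i => ∑ j ∈ Finset.Ico i n, c j) ?_ (a := 0) (σ := σ.setReg r 0)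
    ⟨by simp, by omega, hJ _ _ _ h0, ?_⟩
  · rw [RAM.forVerts, runs_seq, runs_op]
    refine key.mono ?_
    rintro t τ ⟨i, ⟨hi, hin, hJi, hag⟩, hb, ht⟩
    have hs := (hσ.of_agree hag hsafe).size
    simp only [Test.holds, hi, hs] at hb
    obtain rfl : i = n := by omega
    refine ⟨?_, hJi, hag⟩
    have : ∑ j ∈ Finset.Ico 0 i, c j = ∑ v, (cost v + 2) := by
      rw [← Finset.range_eq_Ico, Finset.sum_range]
      exact Finset.sum_congr rfl fun v _ => by simp [c]
    omega
  · rintro i τ ⟨hi, hin, hJi, hag⟩ hb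
    have hτ := hσ.of_agree hag hsafe
    simp only [Test.holds, hi, hτ.size] at hb
    rw [runs_seq]
    refine (hp ⟨i, hb⟩ τ hτ hag hJi hi).agreeOutside.mono ?_
    rintro t υ ⟨⟨ht, hJυ⟩, hag'⟩
    rw [runs_op]
    refine ⟨i + 1, ⟨?_, hb, hJ _ _ _ hJυ, ?_⟩, ?_⟩
    · simp [Op.apply, hag'.reg r hr, hi]
    · exact (hag.trans (hag'.mono (by simp) (by simp))).trans
        ((Op.agreeOutside (.succ r) υ).mono (by simp [Op.regs]) (by simp [Op.arrs]))
    · rw [Finset.sum_eq_sum_Ico_succ_bot hb]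
      simp only [c, hb, dite_true]
      omega
  · exact (Op.agreeOutside (.const r 0) σ).mono (by simp [Op.regs]) (by simp [Op.arrs])

/-- For all neighbours of the vertex in register `r` do `p`, with the neighbour in register `9`. -/
def forNbrs (r : ℕ) (p : Prog) : Prog :=
  .seq (.op (.copy 7 r)) <| .seq (.op (.succ 7)) <| .seq (.op (.load 8 0 7)) <|
  .seq (.op (.load 7 0 r)) <|
  .loop (.lt 7 8) (.seq (.op (.load 9 1 7)) (.seq p (.op (.succ 7))))

/-- The invariant refers to the list of neighbours already treated. Each turn pays `3` beyond the
body (test, load, increment); the final `5` is four initial operations and the failing test.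
Register `7` first serves to read the end of the list, whence `r ≠ 7`; register `8` is filled before
`r` is read again, whence `r ≠ 8`. -/
theorem Runs.forNbrs {L : AdjLists G} {r : ℕ} {p : Prog} {σ : State} {v : Fin n}
    (J : List (Fin n) → State → Prop) (c : ℕ) (hσ : HasInput L σ) (hv : σ.reg r = v)
    (h7 : 7 ∉ p.regs) (h8 : 8 ∉ p.regs) (hr : r ≠ 7 ∧ r ≠ 8)
    (hsafe : Safe (7 :: 8 :: 9 :: p.regs) p.arrs)
    (hJ : ∀ l τ s x, s = 7 ∨ s = 8 ∨ s = 9 → J l τ → J l (τ.setReg s x)) (h0 : J [] σ)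
    (hp : ∀ (l : List (Fin n)) (w : Fin n) (τ : State), HasInput L τ →
      AgreeOutside (7 :: 8 :: 9 :: p.regs) p.arrs σ τ → w ∈ L.nbrs v → w ∉ l →
      J l τ → τ.reg 9 = w → Runs p τ fun t υ => t ≤ c ∧ J (l ++ [w]) υ) :
    Runs (forNbrs r p) σ fun t τ => t ≤ (L.nbrs v).length * (c + 3) + 5 ∧ J (L.nbrs v) τ ∧
      AgreeOutside (7 :: 8 :: 9 :: p.regs) p.arrs σ τ := by
  have key := fun a σ' h => Runs.loop (b := .lt 7 8)
    (p := .seq (.op (.load 9 1 7)) (.seq p (.op (.succ 7))))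
    (fun j τ => τ.reg 7 = L.start v + j ∧ τ.reg 8 = L.start v + (L.nbrs v).length ∧
      j ≤ (L.nbrs v).length ∧ J ((L.nbrs v).take j) τ ∧
      AgreeOutside (7 :: 8 :: 9 :: p.regs) p.arrs σ τ)
    (fun j => ((L.nbrs v).length - j) * (c + 3)) ?_ (a := a) (σ := σ') h
  · simp only [RAM.forNbrs, runs_seq, runs_op]
    refine (key 0 _ ?_).mono ?_
    · have h1 := hσ.arr_zero (i := v) (by omega)
      have h2 := hσ.arr_zero (i := v + 1) (by omega)
      refine ⟨?_, ?_, by omega, ?_, ?_⟩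
      · simp [Op.apply, hr.1, hr.2, hv, h1]
      · simp [Op.apply, hv, h2, L.start_succ]
      · exact hJ _ _ _ _ (by simp) (hJ _ _ _ _ (by simp) (hJ _ _ _ _ (by simp)
          (hJ _ _ _ _ (by simp) h0)))
      · refine ⟨fun s hs => ?_, fun a ha => rfl⟩
        simp only [List.mem_cons, not_or] at hs
        simp [Op.apply, hs.1, hs.2.1]
    · rintro t τ ⟨j, ⟨hi, h8', hin, hJi, hag⟩, hb, ht⟩
      simp only [Test.holds, hi, h8'] at hb
      obtain rfl : j = (L.nbrs v).length := by omega
      rw [List.take_length] at hJi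
      refine ⟨?_, hJi, hag⟩
      simp only [Nat.sub_self, Nat.sub_zero, Nat.zero_mul] at ht
      omega
  · rintro j τ ⟨hi, h8', hin, hJi, hag⟩ hb
    have hτ := hσ.of_agree hag hsafe
    simp only [Test.holds, hi, h8'] at hb
    have hj : j < (L.nbrs v).length := by omega
    simp only [runs_seq, runs_op]
    have hag9 : AgreeOutside (7 :: 8 :: 9 :: p.regs) p.arrs σ ((Op.load 9 1 7).apply τ) :=
      hag.trans ((Op.agreeOutside _ τ).mono (by simp [Op.regs]) (by simp [Op.arrs]))
    refine (hp ((L.nbrs v).take j) (L.nbrs v)[j] _ (hσ.of_agree hag9 hsafe) hag9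
      (List.getElem_mem hj) ?_ (hJ _ _ _ _ (by simp) hJi) ?_).agreeOutside.mono ?_
    · have hnd := L.nodup v
      rw [← List.take_append_drop j (L.nbrs v), List.drop_eq_getElem_cons hj] at hnd
      exact fun hmem => (List.nodup_append.1 hnd).2.2 _ hmem _ List.mem_cons_self rfl
    · simp [Op.apply, hi, hτ.arr_one v hj]
    · rintro t υ ⟨⟨ht, hJυ⟩, hag'⟩
      refine ⟨j + 1, ⟨?_, ?_, hj, ?_, ?_⟩, ?_⟩
      · simp [Op.apply, hag'.reg 7 h7, hi, add_assoc]
      · simp [Op.apply, hag'.reg 8 h8, h8']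
      · rw [List.take_add_one, List.getElem?_eq_getElem hj]
        exact hJ _ _ _ _ (by simp) hJυ
      · exact (hag9.trans (hag'.mono (by intro; simp; tauto) (by simp))).trans
          ((Op.agreeOutside (.succ 7) υ).mono (by simp [Op.regs]) (by simp [Op.arrs]))
      · rw [show (L.nbrs v).length - j = ((L.nbrs v).length - (j + 1)) + 1 by omega, Nat.add_mul]
        omega

end RAM

/-! ### Classes of the vertices with respect to a triple. -/

namespace RAM

variable {n : ℕ} {G : SimpleGraph (Fin n)} {L : AdjLists G}

/-- Set the cells of array `a` that belong to vertices to zero. -/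
def clearArr (a : ℕ) : Prog := forVerts 10 (.op (.store a 10 2))

theorem runs_clearArr {σ : State} (hσ : HasInput L σ) (a : ℕ) (ha : a ≠ 0 ∧ a ≠ 1) :
    Runs (clearArr a) σ fun t τ => t ≤ 3 * n + 2 ∧ (∀ v : Fin n, τ.arr a v = 0) ∧
      AgreeOutside [10] [a] σ τ := by
  refine (Runs.forVerts (L := L) (fun i τ => ∀ v : Fin n, (v : ℕ) < i → τ.arr a v = 0)
    (fun _ => 1) hσ (by simp [Prog.regs, Op.regs]) ?_ ?_ (by simp) ?_).mono ?_
  · simp [Safe, Prog.regs, Prog.arrs, Op.regs, Op.arrs, ha.1.symm, ha.2.symm]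
  · intro i τ x h v hv
    simpa using h v hv
  · intro v τ hτ _ h hv
    simp only [runs_op, Op.apply, hτ.zero, hv, State.arr_setArr, le_refl, true_and]
    intro w hw
    by_cases hwv : (w : ℕ) = v
    · simp [hwv]
    · simpa [hwv] using h w (by omega)
  · rintro t τ ⟨ht, h, hag⟩
    refine ⟨?_, fun v => h v v.isLt, hag⟩
    simp only [Finset.sum_const, Finset.card_univ, Fintype.card_fin, smul_eq_mul] at ht
    omega

/-- For the neighbours of the vertex in register `r`, replace the class `0` by `i` and other
classes by `4`; the classes are in array `2`. -/
def markNbrs (r i : ℕ) : Prog := forNbrs r <|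
  .seq (.op (.load 11 2 9)) <| .ite (.eq 11 2)
    (.seq (.op (.const 11 i)) (.op (.store 2 9 11)))
    (.seq (.op (.const 11 4)) (.op (.store 2 9 11)))

open Classical in
/-- The classes after marking the neighbours of `b`. -/
noncomputable def markedClass (G : SimpleGraph (Fin n)) (b : Fin n) (i : ℕ) (f : Fin n → ℕ)
    (w : Fin n) : ℕ :=
  if G.Adj b w then (if f w = 0 then i else 4) else f w

theorem runs_markNbrs {σ : State} (hσ : HasInput L σ) {r i : ℕ} (hr : r ≠ 7 ∧ r ≠ 8) {b : Fin n}
    (hb : σ.reg r = b) {f : Fin n → ℕ} (hf : ∀ v : Fin n, σ.arr 2 v = f v) :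
    Runs (markNbrs r i) σ fun t τ => t ≤ (L.nbrs b).length * 7 + 5 ∧
      (∀ v : Fin n, τ.arr 2 v = markedClass G b i f v) ∧
      AgreeOutside [7, 8, 9, 11] [2] σ τ := by
  classical
  refine (Runs.forNbrs (L := L) (v := b)
    (fun l τ => ∀ w : Fin n, τ.arr 2 w = if w ∈ l then (if f w = 0 then i else 4) else f w) 4 hσ hb
    (by simp [Prog.regs, Op.regs]) (by simp [Prog.regs, Op.regs]) hr
    (by simp [Safe, Prog.regs, Prog.arrs, Op.regs, Op.arrs]) ?_ (by simpa using hf) ?_).mono ?_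
  · intro l τ s x _ h w
    simpa using h w
  · intro l w τ hτ _ hw hwl h h9
    have hfw : τ.arr 2 w = f w := by simpa [hwl] using h w
    simp only [runs_seq, runs_op, runs_ite, Op.apply, Test.holds, State.reg_setReg, h9, hfw,
      hτ.zero, State.arr_setReg, State.arr_setArr]
    refine ⟨fun h0 => ⟨by norm_num, fun x => ?_⟩, fun h0 => ⟨by norm_num, fun x => ?_⟩⟩ <;>
    · by_cases hx : x = w
      · subst hx
        simp_all
      · have := h x
        simp_all [Fin.ext_iff]
  · rintro t τ ⟨ht, h, hag⟩
    refine ⟨ht, fun v => ?_, hag.mono ?_ ?_⟩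
    · rw [h, markedClass]
      simp only [L.mem_iff]
    · simp [Prog.regs, Op.regs]
    · simp [Prog.arrs, Op.arrs]

/-- Compute the classes of the vertices with respect to the vertices in the registers `4, 5, 6`. -/
def classify : Prog :=
  .seq (clearArr 2) <| .seq (markNbrs 4 1) <| .seq (markNbrs 5 2) (markNbrs 6 3)

/-- The class of a vertex: `0` if it has no neighbour among `b₁, b₂, b₃`, the index of the
neighbour if it has one, and `4` if it has several. -/
noncomputable def vertexClass (G : SimpleGraph (Fin n)) (b₁ b₂ b₃ : Fin n) : Fin n → ℕ :=
  markedClass G b₃ 3 (markedClass G b₂ 2 (markedClass G b₁ 1 fun _ => 0))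

theorem vertexClass_eq_zero {b₁ b₂ b₃ w : Fin n} :
    vertexClass G b₁ b₂ b₃ w = 0 ↔ w ∈ G.farVerts b₁ b₂ b₃ := by
  simp only [vertexClass, markedClass, SimpleGraph.farVerts, Set.mem_ofPred_eq]
  split_ifs <;> simp_all

theorem vertexClass_eq_one {b₁ b₂ b₃ w : Fin n} :
    vertexClass G b₁ b₂ b₃ w = 1 ↔ w ∈ G.privateNbrs b₁ b₂ b₃ := by
  simp only [vertexClass, markedClass, SimpleGraph.privateNbrs, Set.mem_ofPred_eq]
  split_ifs <;> simp_all

theorem vertexClass_eq_two {b₁ b₂ b₃ w : Fin n} :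
    vertexClass G b₁ b₂ b₃ w = 2 ↔ w ∈ G.privateNbrs b₂ b₁ b₃ := by
  simp only [vertexClass, markedClass, SimpleGraph.privateNbrs, Set.mem_ofPred_eq]
  split_ifs <;> simp_all

theorem vertexClass_eq_three {b₁ b₂ b₃ w : Fin n} :
    vertexClass G b₁ b₂ b₃ w = 3 ↔ w ∈ G.privateNbrs b₃ b₁ b₂ := by
  simp only [vertexClass, markedClass, SimpleGraph.privateNbrs, Set.mem_ofPred_eq]
  split_ifs <;> simp_all

/-- No vertex is adjacent to itself, so `b₁` has class `4` exactly when it sees both `b₂` and `b₃`,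
and similarly for `b₂`. The classes thus decide whether the triple is a triangle, without an
adjacency matrix. -/
theorem vertexClass_eq_four {b₁ b₂ b₃ : Fin n} :
    vertexClass G b₁ b₂ b₃ b₁ = 4 ∧ vertexClass G b₁ b₂ b₃ b₂ = 4 ↔
      G.Adj b₁ b₂ ∧ G.Adj b₁ b₃ ∧ G.Adj b₂ b₃ := by
  simp only [vertexClass, markedClass, SimpleGraph.irrefl, if_false]
  have h12 := G.adj_comm b₁ b₂
  have h13 := G.adj_comm b₁ b₃
  have h23 := G.adj_comm b₂ b₃
  split_ifs <;> simp_all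

theorem length_nbrs_le (L : AdjLists G) (v : Fin n) :
    (L.nbrs v).length ≤ ∑ w, (L.nbrs w).length :=
  Finset.single_le_sum (f := fun w => (L.nbrs w).length) (fun _ _ => Nat.zero_le _)
    (Finset.mem_univ v)

theorem runs_classify {σ : State} (hσ : HasInput L σ) {b₁ b₂ b₃ : Fin n} (h4 : σ.reg 4 = b₁)
    (h5 : σ.reg 5 = b₂) (h6 : σ.reg 6 = b₃) :
    Runs classify σ fun t τ => t ≤ 3 * n + 21 * ∑ v, (L.nbrs v).length + 17 ∧
      (∀ v : Fin n, τ.arr 2 v = vertexClass G b₁ b₂ b₃ v) ∧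
      AgreeOutside [7, 8, 9, 10, 11] [2] σ τ := by
  have d1 := length_nbrs_le L b₁
  have d2 := length_nbrs_le L b₂
  have d3 := length_nbrs_le L b₃
  simp only [classify, runs_seq]
  refine (runs_clearArr hσ 2 (by simp)).mono ?_
  rintro t₀ τ₀ ⟨ht₀, hf₀, hag₀⟩
  replace hag₀ : AgreeOutside [7, 8, 9, 10, 11] [2] σ τ₀ := hag₀.mono (by simp) (by simp)
  refine (runs_markNbrs (hσ.of_agree hag₀ (by decide)) (by simp)
    ((hag₀.reg 4 (by simp)).trans h4) hf₀).mono ?_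
  rintro t₁ τ₁ ⟨ht₁, hf₁, hag₁⟩
  replace hag₁ := hag₀.trans (hag₁.mono (by simp) (by simp))
  refine (runs_markNbrs (hσ.of_agree hag₁ (by decide)) (by simp)
    ((hag₁.reg 5 (by simp)).trans h5) hf₁).mono ?_
  rintro t₂ τ₂ ⟨ht₂, hf₂, hag₂⟩
  replace hag₂ := hag₁.trans (hag₂.mono (by simp) (by simp))
  refine (runs_markNbrs (hσ.of_agree hag₂ (by decide)) (by simp)
    ((hag₂.reg 6 (by simp)).trans h6) hf₂).mono ?_
  rintro t₃ τ₃ ⟨ht₃, hf₃, hag₃⟩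
  exact ⟨by omega, hf₃, hag₂.trans (hag₃.mono (by simp) (by simp))⟩

/-! ### Breadth-first search. -/

/-- Array `a` is the indicator function of a set of vertices. -/
def Indicates (τ : State) (a : ℕ) (R : Fin n → Prop) : Prop :=
  ∀ v : Fin n, τ.arr a v ≤ 1 ∧ (τ.arr a v = 1 ↔ R v)

/-- Array `5` up to the position in register `13` contains the queue `q`. -/
structure HasQueue (q : List (Fin n)) (τ : State) : Prop where
  nodup : q.Nodup
  length : τ.reg 13 = q.length
  get : ∀ j (h : j < q.length), τ.arr 5 j = q[j]

theorem HasQueue.congr {q : List (Fin n)} {τ υ : State} (h : HasQueue q τ)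
    (hr : υ.reg 13 = τ.reg 13) (ha : υ.arr 5 = τ.arr 5) : HasQueue q υ :=
  ⟨h.nodup, hr.trans h.length, fun j hj => by rw [ha]; exact h.get j hj⟩

theorem HasQueue.push {q : List (Fin n)} {τ υ : State} (h : HasQueue q τ) {v : Fin n}
    (hv : v ∉ q) (hr : υ.reg 13 = τ.reg 13 + 1)
    (ha : ∀ j, υ.arr 5 j = if j = τ.reg 13 then (v : ℕ) else τ.arr 5 j) :
    HasQueue (q ++ [v]) υ := by
  refine ⟨List.nodup_append.2 ⟨h.nodup, by simp, ?_⟩, by simp [hr, h.length], fun j hj => ?_⟩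
  · rintro a ha b hb rfl
    exact hv (by simp_all)
  · rw [ha, h.length]
    rcases (show j = q.length ∨ j < q.length by simp at hj; omega) with rfl | hj'
    · simp
    · rw [if_neg hj'.ne, h.get j hj', List.getElem_append_left hj']

/-- Mark the vertex in register `r` in array `out`, and append it to the queue. -/
def push (out r : ℕ) : Prog :=
  .seq (.op (.store out r 3)) <| .seq (.op (.store 5 13 r)) (.op (.succ 13))

/-- Start a search: array `out` marks the vertices of class `i`, and they form the queue. -/
def startSearch (i out : ℕ) : Prog :=
  .seq (.op (.const 12 0)) <| .seq (.op (.const 13 0)) <| .seq (.op (.const 15 i)) <|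
  forVerts 10 <| .seq (.op (.store out 10 2)) <| .seq (.op (.load 11 2 10)) <|
    .ite (.eq 11 15) (push out 10) .skip

/-- The marks are reset in the same pass that sets them, and the queue is emptied by resetting
registers `12` and `13`; leftovers from earlier triples do no harm. -/
theorem runs_startSearch {σ : State} (hσ : HasInput L σ) {i out : ℕ}
    (hout : out ≠ 0 ∧ out ≠ 1 ∧ out ≠ 2 ∧ out ≠ 5) {f : Fin n → ℕ}
    (hf : ∀ v : Fin n, σ.arr 2 v = f v) :
    Runs (startSearch i out) σ fun t τ => t ≤ 8 * n + 5 ∧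
      (∃ q, HasQueue q τ ∧ (∀ v, v ∈ q ↔ f v = i) ∧ Indicates τ out (· ∈ q)) ∧ τ.reg 12 = 0 ∧
      AgreeOutside [10, 11, 12, 13, 15] [out, 5] σ τ := by
  obtain ⟨ho0, ho1, ho2, ho5⟩ := hout
  simp only [startSearch, runs_seq, runs_op]
  set σ' := (Op.const 15 i).apply ((Op.const 13 0).apply ((Op.const 12 0).apply σ)) with hσ'
  have hag : AgreeOutside [10, 11, 12, 13, 15] [out, 5] σ σ' := by
    refine ⟨fun r hr => ?_, fun a _ => rfl⟩
    simp only [List.mem_cons, not_or] at hr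
    simp [hσ', Op.apply, hr]
  refine (Runs.forVerts (L := L) (fun k τ => ∃ q, HasQueue q τ ∧
      (∀ v : Fin n, v ∈ q ↔ (v : ℕ) < k ∧ f v = i) ∧
      ∀ v : Fin n, (v : ℕ) < k → τ.arr out v ≤ 1 ∧ (τ.arr out v = 1 ↔ v ∈ q))
    (fun _ => 6) (hσ.of_agree hag ?_) (by simp [Prog.regs, Op.regs, push]) ?_ ?_ ?_ ?_).mono ?_
  · simp [Safe, ho0.symm, ho1.symm]
  · simp [Safe, Prog.regs, Prog.arrs, Op.regs, Op.arrs, push, ho0.symm, ho1.symm]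
  · rintro k τ x ⟨q, hq, hmem, hind⟩
    exact ⟨q, hq.congr (by simp) rfl, hmem, hind⟩
  · exact ⟨[], ⟨by simp, by simp [hσ', Op.apply], by simp⟩, by simp, by simp⟩
  · rintro v τ hτ hag' ⟨q, hq, hmem, hind⟩ hv
    have h15 : τ.reg 15 = i := by
      rw [hag'.reg 15 (by simp [Prog.regs, Op.regs, push])]
      simp [hσ', Op.apply]
    have h2 : τ.arr 2 v = f v := by
      rw [hag'.arr 2 (by simp [Prog.arrs, Op.arrs, push, ho2.symm]), ← hf]
      rfl
    have hvq : v ∉ q := by simp [hmem]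
    simp only [runs_seq, runs_op, runs_ite, runs_skip, push, Op.apply, Test.holds,
      State.reg_setReg, State.reg_setArr, State.arr_setReg, State.arr_setArr, hv, h2, h15, hτ.zero,
      hτ.one, ho2.symm]
    refine ⟨fun hi => ⟨by norm_num, q ++ [v], hq.push hvq ?_ ?_, ?_, ?_⟩,
      fun hi => ⟨by norm_num, q, hq.congr ?_ ?_, ?_, ?_⟩⟩
    · simp
    · intro j
      simp [ho5.symm]
    · intro w
      simp only [List.mem_append, hmem, List.mem_singleton, Fin.ext_iff]
      constructor
      · rintro (⟨h1, h2⟩ | h)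
        · exact ⟨by omega, h2⟩
        · obtain rfl := Fin.ext h
          exact ⟨by omega, by simpa using hi⟩
      · rintro ⟨h1, h2⟩
        by_cases h : (w : ℕ) < v
        · exact Or.inl ⟨h, h2⟩
        · exact Or.inr (by omega)
    · intro w hw
      by_cases hwv : w = v
      · subst hwv
        simp [ho5]
      · have hwv' : (w : ℕ) ≠ v := fun h => hwv (Fin.ext h)
        have := hind w (by omega)
        simpa [ho5, hwv, hwv'] using this
    · simp
    · ext j
      simp [ho5.symm]
    · intro w
      rw [hmem]
      refine ⟨fun h => ⟨by omega, h.2⟩, fun h => ⟨?_, h.2⟩⟩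
      refine lt_of_le_of_ne (by omega) fun hwv => hi ?_
      obtain rfl := Fin.ext hwv
      simpa using h.2
    · intro w hw
      by_cases hwv : w = v
      · subst hwv
        simp [hvq]
      · have hwv' : (w : ℕ) ≠ v := fun h => hwv (Fin.ext h)
        have := hind w (by omega)
        simpa [hwv'] using this
  · rintro t τ ⟨ht, ⟨q, hq, hmem, hind⟩, hag'⟩
    simp only [Finset.sum_const, Finset.card_univ, Fintype.card_fin, smul_eq_mul] at ht
    refine ⟨by omega, ⟨q, hq, by simpa using hmem, fun v => hind v v.isLt⟩, ?_,
      hag.trans (hag'.mono ?_ ?_)⟩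
    · rw [hag'.reg 12 (by simp [Prog.regs, Op.regs, push])]
      simp [hσ', Op.apply]
    · simp [Prog.regs, Op.regs, push]
    · simp [Prog.arrs, Op.arrs, push]

/-- Visit the neighbours of the vertex in register `14`: those of class `0` that are not yet marked
in array `out` are marked and appended to the queue. -/
def visitNbrs (out : ℕ) : Prog :=
  forNbrs 14 <| .seq (.op (.load 11 2 9)) <| .ite (.eq 11 2)
    (.seq (.op (.load 11 out 9)) (.ite (.eq 11 2) (push out 9) .skip)) .skip

/-- Marked vertices and queued vertices are the same set. Testing the mark before pushing therefore
keeps the queue free of repetitions, on which the time bound of the search rests. -/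
theorem runs_visitNbrs {σ : State} (hσ : HasInput L σ) {out : ℕ}
    (hout : out ≠ 0 ∧ out ≠ 1 ∧ out ≠ 2 ∧ out ≠ 5) {f : Fin n → ℕ}
    (hf : ∀ v : Fin n, σ.arr 2 v = f v) {v : Fin n} (hv : σ.reg 14 = v) {q : List (Fin n)}
    (hq : HasQueue q σ) (hind : Indicates σ out (· ∈ q)) :
    Runs (visitNbrs out) σ fun t τ => t ≤ (L.nbrs v).length * 10 + 5 ∧
      (∃ q', HasQueue (q ++ q') τ ∧ Indicates τ out (· ∈ q ++ q') ∧
        (∀ w ∈ q', G.Adj v w ∧ f w = 0) ∧ ∀ w, G.Adj v w → f w = 0 → w ∈ q ++ q') ∧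
      AgreeOutside [7, 8, 9, 11, 13] [out, 5] σ τ := by
  obtain ⟨ho0, ho1, ho2, ho5⟩ := hout
  refine (Runs.forNbrs (L := L) (v := v) (fun l τ => ∃ q', HasQueue (q ++ q') τ ∧
        Indicates τ out (· ∈ q ++ q') ∧
        (∀ w ∈ q', G.Adj v w ∧ f w = 0) ∧ ∀ w ∈ l, f w = 0 → w ∈ q ++ q') 7 hσ hv
    (by simp [Prog.regs, Op.regs, push]) (by simp [Prog.regs, Op.regs, push]) (by simp)
    ?_ ?_ ?_ ?_).mono ?_
  · simp [Safe, Prog.regs, Prog.arrs, Op.regs, Op.arrs, push, ho0.symm, ho1.symm]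
  · rintro l τ s x hs ⟨q', h1, h2, h3, h4⟩
    refine ⟨q', h1.congr ?_ rfl, h2, h3, h4⟩
    rw [State.reg_setReg, if_neg (by omega)]
  · exact ⟨[], by simpa using hq, by simpa using hind, by simp, by simp⟩
  · rintro l w τ hτ hag hw _ ⟨q', h1, h2, h3, h4⟩ h9
    have hfw : τ.arr 2 w = f w := by
      rw [hag.arr 2 (by simp [Prog.arrs, Op.arrs, push, ho2.symm]), hf]
    have hl : ∀ x ∈ l ++ [w], f x = 0 → x ∈ q ++ q' ∨ (x = w ∧ f w = 0) := by
      intro x hx hx0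
      rcases List.mem_append.1 hx with hx | hx
      · exact Or.inl (h4 x hx hx0)
      · obtain rfl := List.mem_singleton.1 hx
        exact Or.inr ⟨rfl, hx0⟩
    simp only [runs_seq, runs_op, runs_ite, runs_skip, push, Op.apply, Test.holds,
      State.reg_setReg, State.reg_setArr, State.arr_setReg, h9, hfw, hτ.zero, hτ.one]
    refine ⟨fun hw0 => ⟨fun hout => ⟨by norm_num, q' ++ [w], ?_⟩,
      fun hout => ⟨by norm_num, q', h1.congr ?_ rfl, h2, h3, ?_⟩⟩,
      fun hw0 => ⟨by norm_num, q', h1.congr ?_ rfl, h2, h3, ?_⟩⟩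
    · simp only [reduceIte, Nat.reduceEqDiff] at hw0 hout
      have hwq : w ∉ q ++ q' := by
        intro hmem
        have := (h2 w).2.2 hmem
        omega
      rw [← List.append_assoc]
      refine ⟨h1.push hwq (by simp) (by intro j; simp [ho5.symm]), ?_, ?_, ?_⟩
      · intro x
        by_cases hxw : x = w
        · subst hxw
          simp [ho5]
        · have hxw' : (x : ℕ) ≠ w := fun h => hxw (Fin.ext h)
          simpa [hxw, hxw', ho5] using h2 x
      · intro x hx
        rcases List.mem_append.1 hx with hx | hx
        · exact h3 x hx
        · obtain rfl := List.mem_singleton.1 hx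
          exact ⟨(L.mem_iff _ _).1 hw, hw0⟩
      · intro x hx hx0
        rcases hl x hx hx0 with h | ⟨rfl, _⟩
        · exact List.mem_append_left _ h
        · simp
    · simp
    · simp only [reduceIte, Nat.reduceEqDiff] at hw0 hout
      intro x hx hx0
      rcases hl x hx hx0 with h | ⟨rfl, _⟩
      · exact h
      · have := h2 x
        exact this.2.1 (by omega)
    · simp
    · simp only [reduceIte, Nat.reduceEqDiff] at hw0
      intro x hx hx0
      rcases hl x hx hx0 with h | ⟨_, h⟩
      · exact h
      · exact absurd h hw0
  · rintro t τ ⟨ht, ⟨q', h1, h2, h3, h4⟩, hag⟩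
    refine ⟨ht, ⟨q', h1, h2, h3, fun w hw => h4 w ((L.mem_iff _ _).2 hw)⟩, hag.mono ?_ ?_⟩
    · simp [Prog.regs, Op.regs, push]
    · simp [Prog.arrs, Op.arrs, push]

/-- Mark in array `out` the vertices that can be reached from vertices of class `i` through vertices
of class `0`. -/
def search (i out : ℕ) : Prog :=
  .seq (startSearch i out) <| .loop (.lt 12 13) <|
    .seq (.op (.load 14 5 12)) <| .seq (.op (.succ 12)) (visitNbrs out)

theorem runs_search {σ : State} (hσ : HasInput L σ) {i out : ℕ}
    (hout : out ≠ 0 ∧ out ≠ 1 ∧ out ≠ 2 ∧ out ≠ 5) {f : Fin n → ℕ}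
    (hf : ∀ v : Fin n, σ.arr 2 v = f v) :
    Runs (search i out) σ fun t τ => t ≤ 10 * ∑ v, (L.nbrs v).length + 16 * n + 6 ∧
      Indicates τ out (G.ReachIn {v | f v = i} {v | f v = 0}) ∧
      AgreeOutside [7, 8, 9, 10, 11, 12, 13, 14, 15] [out, 5] σ τ := by
  classical
  have ho0 := hout.1
  have ho1 := hout.2.1
  have ho2 := hout.2.2.1
  have ho5 := hout.2.2.2
  rw [search, runs_seq]
  refine (runs_startSearch hσ hout hf).mono ?_
  rintro t₀ τ₀ ⟨ht₀, ⟨q, hq, hmem, hind⟩, h12, hag₀⟩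
  have hsafe : Safe [7, 8, 9, 10, 11, 12, 13, 14, 15] [out, 5] := by
    simp [Safe, ho0.symm, ho1.symm]
  replace hag₀ : AgreeOutside [7, 8, 9, 10, 11, 12, 13, 14, 15] [out, 5] σ τ₀ :=
    hag₀.mono (by simp) (by simp)
  -- The auxiliary value splits the queue into the vertices already processed, `a.1`, and those
  -- pending, `a.2`. The potential charges each unprocessed vertex `10` per neighbour plus `8`: `5`
  -- for the overhead of the visit and `3` for test, load and increment.
  refine (Runs.loop (α := List (Fin n) × List (Fin n)) (fun a τ =>
      τ.reg 12 = a.1.length ∧ HasQueue (a.1 ++ a.2) τ ∧ Indicates τ out (· ∈ a.1 ++ a.2) ∧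
      (∀ v ∈ a.1 ++ a.2, G.ReachIn {v | f v = i} {v | f v = 0} v) ∧
      (∀ v, f v = i → v ∈ a.1 ++ a.2) ∧
      (∀ v ∈ a.1, ∀ w, G.Adj v w → f w = 0 → w ∈ a.1 ++ a.2) ∧
      AgreeOutside [7, 8, 9, 10, 11, 12, 13, 14, 15] [out, 5] σ τ)
    (fun a => ∑ v, if v ∈ a.1 then 0 else ((L.nbrs v).length * 10 + 8)) ?_ (a := ([], q))
    ⟨by simpa using h12, by simpa using hq, by simpa using hind, ?_, ?_, by simp, hag₀⟩).mono ?_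
  · rintro ⟨d, p⟩ τ ⟨h12, hq, hind, hreach, hA, hcl, hag⟩ hb
    simp only at h12 hq hind hreach hA hcl
    simp only [Test.holds, h12, hq.length, List.length_append] at hb
    obtain ⟨v, p, rfl⟩ : ∃ v p', p = v :: p' := List.exists_cons_of_length_pos (by omega)
    have h5 : τ.arr 5 d.length = v := by
      rw [hq.get d.length (by simp)]
      simp
    have hvd : v ∉ d := by
      have := (List.nodup_append.1 hq.nodup).2.2
      exact fun h => this v h v (by simp) rfl
    simp only [runs_seq, runs_op]
    set τ' := (Op.succ 12).apply ((Op.load 14 5 12).apply τ) with hτ'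
    have hag' : AgreeOutside [7, 8, 9, 10, 11, 12, 13, 14, 15] [out, 5] σ τ' :=
      hag.trans (((Op.agreeOutside _ _).mono (by simp [Op.regs]) (by simp [Op.arrs])).trans
        ((Op.agreeOutside _ _).mono (by simp [Op.regs]) (by simp [Op.arrs])))
    refine (runs_visitNbrs (hσ.of_agree hag' hsafe) hout
      (f := f) (v := v) (q := d ++ v :: p) ?_ ?_ ?_ ?_).mono ?_
    · intro w
      rw [hag'.arr 2 (by simp [ho2.symm]), hf]
    · simp [hτ', Op.apply, h12, h5]
    · exact hq.congr (by simp [hτ', Op.apply]) rfl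
    · exact hind
    · rintro t υ ⟨ht, ⟨q', hq', hind', hnew, hall⟩, hag''⟩
      have heq : d ++ v :: p ++ q' = (d ++ [v]) ++ (p ++ q') := by simp
      refine ⟨(d ++ [v], p ++ q'), ⟨?_, ?_, ?_, ?_, ?_, ?_, ?_⟩, ?_⟩
      · rw [hag''.reg 12 (by simp)]
        simp [hτ', Op.apply, h12]
      · rwa [← heq]
      · rwa [← heq]
      · simp only [← heq]
        intro w hw
        rcases List.mem_append.1 hw with hw | hw
        · exact hreach w hw
        · exact .step (hreach v (by simp)) (hnew w hw).1 (hnew w hw).2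
      · simp only [← heq]
        exact fun w hw => List.mem_append_left _ (hA w hw)
      · simp only [← heq]
        intro u hu w huw hw
        rcases List.mem_append.1 hu with hu | hu
        · exact List.mem_append_left _ (hcl u hu w huw hw)
        · obtain rfl := List.mem_singleton.1 hu
          exact hall w huw hw
      · exact hag'.trans (hag''.mono (by simp) (by simp))
      · rw [← Finset.add_sum_erase _ _ (Finset.mem_univ v),
          ← Finset.add_sum_erase (a := v) Finset.univ
            (fun v => if v ∈ d then 0 else ((L.nbrs v).length * 10 + 8)) (Finset.mem_univ v)]
        have : ∑ x ∈ Finset.univ.erase v,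
            (if x ∈ d ++ [v] then 0 else ((L.nbrs x).length * 10 + 8)) =
            ∑ x ∈ Finset.univ.erase v,
            (if x ∈ d then 0 else ((L.nbrs x).length * 10 + 8)) := by
          refine Finset.sum_congr rfl fun x hx => ?_
          simp [Finset.ne_of_mem_erase hx]
        rw [this]
        simp only [hvd, List.mem_append, List.mem_singleton, or_true, if_true, if_false]
        omega
  · intro v hv
    exact .base ((hmem v).1 (by simpa using hv))
  · intro v hv
    simpa using (hmem v).2 hv
  · rintro t τ ⟨⟨d, p⟩, ⟨h12, hq, hind, hreach, hA, hcl, hag⟩, hb, ht⟩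
    simp only at h12 hq hind hreach hA hcl
    simp only [Test.holds, h12, hq.length, List.length_append] at hb
    obtain rfl : p = [] := List.length_eq_zero_iff.1 (by omega)
    refine ⟨?_, ?_, hag⟩
    · simp only [List.not_mem_nil, if_false, Finset.sum_add_distrib, ← Finset.sum_mul,
        Finset.sum_const, Finset.card_univ, Fintype.card_fin, smul_eq_mul] at ht
      omega
    · intro v
      refine ⟨(hind v).1, (hind v).2.trans ⟨hreach v, fun h => ?_⟩⟩
      -- Nothing is pending, so the processed vertices contain the starting class and are closed
      -- under steps to class `0`; hence they contain all that can be reached.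
      induction h with
      | base h => exact hA _ h
      | @step w u _ ha hu ih =>
        rw [List.append_nil] at ih
        exact hcl w ih u ha hu

/-! ### Testing one triple. -/

/-- The answer in register `1` is that of the question `P`. -/
def IsAnswer (τ : State) (P : Prop) : Prop :=
  τ.reg 1 ≤ 1 ∧ (τ.reg 1 = 1 ↔ P)

theorem IsAnswer.congr {σ τ : State} {P Q : Prop} (h : IsAnswer σ P) (hr : τ.reg 1 = σ.reg 1)
    (hPQ : P ↔ Q) : IsAnswer τ Q := by
  rw [IsAnswer, hr, ← hPQ]
  exact h

/-- Set the registers `16` and `17` to `1` if some neighbour of the vertex in register `10` is marked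
in the arrays `3` and `4`, respectively, and to `0` otherwise. -/
def scanNbrs : Prog :=
  .seq (.op (.const 16 0)) <| .seq (.op (.const 17 0)) <| forNbrs 10 <|
    .seq (.op (.load 11 3 9)) <| .seq (.ite (.eq 11 3) (.op (.const 16 1)) .skip) <|
    .seq (.op (.load 11 4 9)) (.ite (.eq 11 3) (.op (.const 17 1)) .skip)

theorem runs_scanNbrs {σ : State} (hσ : HasInput L σ) {v : Fin n} (hv : σ.reg 10 = v)
    {R₂ R₃ : Fin n → Prop} (h2 : Indicates σ 3 R₂) (h3 : Indicates σ 4 R₃) :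
    Runs scanNbrs σ fun t τ => t ≤ (L.nbrs v).length * 9 + 7 ∧
      (τ.reg 16 = 1 ↔ ∃ w, G.Adj v w ∧ R₂ w) ∧ (τ.reg 17 = 1 ↔ ∃ w, G.Adj v w ∧ R₃ w) ∧
      AgreeOutside [7, 8, 9, 11, 16, 17] [] σ τ := by
  simp only [scanNbrs, runs_seq, runs_op]
  set σ' := (Op.const 17 0).apply ((Op.const 16 0).apply σ) with hσ'
  have hag : AgreeOutside [7, 8, 9, 11, 16, 17] [] σ σ' := by
    refine ⟨fun r hr => ?_, fun a _ => rfl⟩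
    simp only [List.mem_cons, not_or] at hr
    simp [hσ', Op.apply, hr]
  refine (Runs.forNbrs (L := L) (v := v) (fun l τ =>
      (τ.reg 16 = 1 ↔ ∃ w ∈ l, R₂ w) ∧ (τ.reg 17 = 1 ↔ ∃ w ∈ l, R₃ w)) 6
    (hσ.of_agree hag (by decide)) ((hag.reg 10 (by decide)).trans hv) (by decide) (by decide)
    (by decide) (by decide) ?_ (by simp [hσ', Op.apply]) ?_).mono ?_
  · rintro l τ s x hs h
    rw [State.reg_setReg, State.reg_setReg, if_neg (by omega), if_neg (by omega)]
    exact h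
  · rintro l w τ hτ hag' hw _ ⟨h16, h17⟩ h9
    have hw2 : τ.arr 3 w = 1 ↔ R₂ w := by
      rw [hag'.arr 3 (by decide)]
      exact (h2 w).2
    have hw3 : τ.arr 4 w = 1 ↔ R₃ w := by
      rw [hag'.arr 4 (by decide)]
      exact (h3 w).2
    have hl : ∀ R : Fin n → Prop, (∃ x ∈ l ++ [w], R x) ↔ (∃ x ∈ l, R x) ∨ R w := by
      intro R
      simp only [List.mem_append, List.mem_singleton, or_and_right, exists_or, exists_eq_left]
    simp only [hl, ← h16, ← h17, ← hw2, ← hw3]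
    simp only [runs_seq, runs_op, runs_ite, runs_skip, Op.apply, Test.holds,
      State.reg_setReg, State.arr_setReg, h9, hτ.one]
    by_cases e2 : τ.arr 3 w = 1 <;> by_cases e3 : τ.arr 4 w = 1 <;> simp [e2, e3]
  · rintro t τ ⟨ht, ⟨h16, h17⟩, hag'⟩
    refine ⟨by omega, by simpa [L.mem_iff] using h16, by simpa [L.mem_iff] using h17,
      hag.trans (hag'.mono ?_ ?_)⟩
    · simp [Prog.regs, Op.regs]
    · simp [Prog.arrs, Op.arrs]

/-- Answer `1` if some vertex of class `1` has a neighbour marked in array `3` and a neighbour marked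
in array `4`. -/
def findCentre : Prog :=
  forVerts 10 <| .seq (.op (.load 11 2 10)) <| .ite (.eq 11 3)
    (.seq scanNbrs <| .ite (.eq 16 3) (.ite (.eq 17 3) (.op (.const 1 1)) .skip) .skip) .skip

theorem runs_findCentre {σ : State} (hσ : HasInput L σ) {f : Fin n → ℕ}
    (hf : ∀ v : Fin n, σ.arr 2 v = f v)
    {R₂ R₃ : Fin n → Prop} (h2 : Indicates σ 3 R₂) (h3 : Indicates σ 4 R₃) {P : Prop}
    (hP : IsAnswer σ P) :
    Runs findCentre σ fun t τ => t ≤ 9 * ∑ v, (L.nbrs v).length + 14 * n + 2 ∧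
      IsAnswer τ (P ∨ ∃ c, f c = 1 ∧ (∃ w, G.Adj c w ∧ R₂ w) ∧ ∃ w, G.Adj c w ∧ R₃ w) ∧
      AgreeOutside [1, 7, 8, 9, 10, 11, 16, 17] [] σ τ := by
  refine (Runs.forVerts (L := L) (fun i τ => IsAnswer τ (P ∨ ∃ c : Fin n, (c : ℕ) < i ∧
      f c = 1 ∧ (∃ w, G.Adj c w ∧ R₂ w) ∧ ∃ w, G.Adj c w ∧ R₃ w))
    (fun v => (L.nbrs v).length * 9 + 12) hσ (by decide) (by decide) ?_ (by simpa using hP)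
    ?_).mono ?_
  · intro i τ x h
    exact h.congr (by simp) Iff.rfl
  · intro v τ hτ hag h hv
    have hfv : τ.arr 2 v = f v := by
      rw [hag.arr 2 (by decide), hf]
    have hl : (∃ c : Fin n, (c : ℕ) < v + 1 ∧ f c = 1 ∧ (∃ w, G.Adj c w ∧ R₂ w) ∧
          ∃ w, G.Adj c w ∧ R₃ w) ↔
        (∃ c : Fin n, (c : ℕ) < v ∧ f c = 1 ∧ (∃ w, G.Adj c w ∧ R₂ w) ∧
          ∃ w, G.Adj c w ∧ R₃ w) ∨
        (f v = 1 ∧ (∃ w, G.Adj v w ∧ R₂ w) ∧ ∃ w, G.Adj v w ∧ R₃ w) := by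
      constructor
      · rintro ⟨c, hc, h⟩
        rcases (show (c : ℕ) < v ∨ (c : ℕ) = v by omega) with hc | hc
        · exact Or.inl ⟨c, hc, h⟩
        · exact Or.inr (Fin.ext hc ▸ h)
      · rintro (⟨c, hc, h⟩ | h)
        · exact ⟨c, by omega, h⟩
        · exact ⟨v, by omega, h⟩
    rw [hl, ← or_assoc]
    -- The answer accumulated so far plays the role of `P` from here on: register `1` is either kept
    -- or set to `1`.
    generalize (P ∨ ∃ c : Fin n, (c : ℕ) < v ∧ f c = 1 ∧ (∃ w, G.Adj c w ∧ R₂ w) ∧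
      ∃ w, G.Adj c w ∧ R₃ w) = P' at *
    simp only [runs_seq, runs_op, runs_ite, runs_skip]
    set τ' := (Op.load 11 2 10).apply τ with hτ'
    have hag' : AgreeOutside [11] [] τ τ' := Op.agreeOutside (.load 11 2 10) τ
    have h11 : τ'.reg 11 = f v := by simp [hτ', Op.apply, hv, hfv]
    have hin := hτ.of_agree hag' (by decide)
    refine ⟨fun hb => ?_, fun hb => ⟨by omega, h.congr (hag'.reg 1 (by decide)) ?_⟩⟩
    · simp only [Test.holds, h11, hin.one] at hb
      refine (runs_scanNbrs hin (v := v) (R₂ := R₂) (R₃ := R₃)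
        ((hag'.reg 10 (by decide)).trans hv) ?_ ?_).mono ?_
      · intro w
        rw [hag'.arr 3 (by decide), hag.arr 3 (by decide)]
        exact h2 w
      · intro w
        rw [hag'.arr 4 (by decide), hag.arr 4 (by decide)]
        exact h3 w
      · rintro t υ ⟨ht, h16, h17, hag''⟩
        have h1 : υ.reg 1 = τ.reg 1 := (hag''.reg 1 (by decide)).trans (hag'.reg 1 (by decide))
        have hone := (hin.of_agree hag'' (by decide)).one
        simp only [Test.holds, hone, Op.apply, h16, h17, hb, true_and]
        refine ⟨fun e2 => ⟨fun e3 => ⟨by omega, by simp [IsAnswer, e2, e3]⟩,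
          fun e3 => ⟨by omega, h.congr h1 ?_⟩⟩, fun e2 => ⟨by omega, h.congr h1 ?_⟩⟩
        · simp [e3]
        · simp [e2]
    · simp only [Test.holds, h11, hin.one] at hb
      simp [hb]
  · rintro t τ ⟨ht, h, hag⟩
    refine ⟨?_, by simpa using h, hag.mono (by decide) (by decide)⟩
    simp only [Finset.sum_add_distrib, ← Finset.sum_mul, Finset.sum_const, Finset.card_univ,
      Fintype.card_fin, smul_eq_mul] at ht
    omega

/-- Answer `1` if the vertices in the registers `4, 5, 6` form a linked triangle. -/
def checkTriple : Prog :=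
  .seq classify <| .seq (.op (.const 15 4)) <| .seq (.op (.load 11 2 4)) <| .ite (.eq 11 15)
    (.seq (.op (.load 11 2 5)) <| .ite (.eq 11 15)
      (.seq (search 2 3) <| .seq (search 3 4) findCentre) .skip) .skip

/-- With `S` the sum of the degrees, classification, the two searches, the scan and five further
steps take at most `49 n + 50 S + 36` steps. The proposition `P` records the answer of earlier
triples, since register `1` is never reset. -/
theorem runs_checkTriple {σ : State} (hσ : HasInput L σ) {b₁ b₂ b₃ : Fin n} (h4 : σ.reg 4 = b₁)
    (h5 : σ.reg 5 = b₂) (h6 : σ.reg 6 = b₃) {P : Prop} (hP : IsAnswer σ P) :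
    Runs checkTriple σ fun t τ => t ≤ 50 * (n + ∑ v, (L.nbrs v).length + 1) ∧
      IsAnswer τ (P ∨ G.IsLinkedTriangle b₁ b₂ b₃) := by
  simp only [checkTriple, runs_seq]
  refine (runs_classify hσ h4 h5 h6).mono ?_
  rintro t₀ τ₀ ⟨ht₀, hf, hag₀⟩
  simp only [runs_seq, runs_op, runs_ite, runs_skip]
  have hag₁ : AgreeOutside [7, 8, 9, 10, 11, 15] [2] σ
      ((Op.load 11 2 4).apply ((Op.const 15 4).apply τ₀)) :=
    (hag₀.mono (by decide) (by decide)).trans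
      (((Op.agreeOutside _ _).mono (by decide) (by decide)).trans
      ((Op.agreeOutside _ _).mono (by decide) (by decide)))
  have h4' := (hag₀.reg 4 (by decide)).trans h4
  have h5' := (hag₀.reg 5 (by decide)).trans h5
  have e1 : Test.holds (.eq 11 15) ((Op.load 11 2 4).apply ((Op.const 15 4).apply τ₀)) ↔
      vertexClass G b₁ b₂ b₃ b₁ = 4 := by
    simp [Test.holds, Op.apply, h4', hf]
  set τ₁ := (Op.load 11 2 4).apply ((Op.const 15 4).apply τ₀) with hτ₁
  have hag₂ : AgreeOutside [7, 8, 9, 10, 11, 15] [2] σ ((Op.load 11 2 5).apply τ₁) :=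
    hag₁.trans ((Op.agreeOutside _ _).mono (by decide) (by decide))
  have hf₂ : ∀ v : Fin n, ((Op.load 11 2 5).apply τ₁).arr 2 v = vertexClass G b₁ b₂ b₃ v := hf
  have e2 : Test.holds (.eq 11 15) ((Op.load 11 2 5).apply τ₁) ↔
      vertexClass G b₁ b₂ b₃ b₂ = 4 := by
    simp [hτ₁, Test.holds, Op.apply, h5', hf]
  rw [e1, e2]
  generalize (Op.load 11 2 5).apply τ₁ = τ₂ at *
  have htri := vertexClass_eq_four (G := G) (b₁ := b₁) (b₂ := b₂) (b₃ := b₃)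
  refine ⟨fun g1 => ⟨fun g2 => ?_, fun g2 => ⟨by omega, hP.congr (hag₂.reg 1 (by decide)) ?_⟩⟩,
    fun g1 => ⟨by omega, hP.congr (hag₁.reg 1 (by decide)) ?_⟩⟩
  · have hA2 : {v | vertexClass G b₁ b₂ b₃ v = 2} = G.privateNbrs b₂ b₁ b₃ :=
      Set.ext fun _ => vertexClass_eq_two
    have hA3 : {v | vertexClass G b₁ b₂ b₃ v = 3} = G.privateNbrs b₃ b₁ b₂ :=
      Set.ext fun _ => vertexClass_eq_three
    have hU : {v | vertexClass G b₁ b₂ b₃ v = 0} = G.farVerts b₁ b₂ b₃ :=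
      Set.ext fun _ => vertexClass_eq_zero
    have hin₂ := hσ.of_agree hag₂ (by decide)
    refine (runs_search hin₂ (i := 2) (out := 3) (by decide) hf₂).mono ?_
    rintro t₃ τ₃ ⟨ht₃, hR₂, hag₃⟩
    have hin₃ := hin₂.of_agree hag₃ (by decide)
    have hf₃ : ∀ v : Fin n, τ₃.arr 2 v = vertexClass G b₁ b₂ b₃ v := by
      rw [hag₃.arr 2 (by decide)]
      exact hf₂
    refine (runs_search hin₃ (i := 3) (out := 4) (by decide) hf₃).mono ?_
    rintro t₄ τ₄ ⟨ht₄, hR₃, hag₄⟩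
    have hin₄ := hin₃.of_agree hag₄ (by decide)
    have hf₄ : ∀ v : Fin n, τ₄.arr 2 v = vertexClass G b₁ b₂ b₃ v := by
      rw [hag₄.arr 2 (by decide)]
      exact hf₃
    have hR₂' : Indicates τ₄ 3 (G.ReachIn (G.privateNbrs b₂ b₁ b₃) (G.farVerts b₁ b₂ b₃)) := by
      intro v
      rw [hag₄.arr 3 (by decide), ← hA2, ← hU]
      exact hR₂ v
    rw [hA3, hU] at hR₃
    have hP₄ : IsAnswer τ₄ P := hP.congr (((hag₄.reg 1 (by decide)).trans
      (hag₃.reg 1 (by decide))).trans (hag₂.reg 1 (by decide))) Iff.rfl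
    refine (runs_findCentre hin₄ hf₄ hR₂' hR₃ hP₄).mono ?_
    rintro t₅ τ₅ ⟨ht₅, hans, -⟩
    refine ⟨by omega, hans.congr rfl ?_⟩
    obtain ⟨h12, h13, h23⟩ := htri.1 ⟨g1, g2⟩
    simp only [vertexClass_eq_one, SimpleGraph.IsLinkedTriangle, h12, h13, h23, true_and]
  · have : ¬ G.IsLinkedTriangle b₁ b₂ b₃ := fun h =>
      g2 (htri.2 ⟨h.1, h.2.1, h.2.2.1⟩).2
    simp [this]
  · have : ¬ G.IsLinkedTriangle b₁ b₂ b₃ := fun h =>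
      g1 (htri.2 ⟨h.1, h.2.1, h.2.2.1⟩).1
    simp [this]

/-! ### All triples and the total running time. -/

/-- Answer whether some triple of vertices is a linked triangle. -/
def detect : Prog :=
  .seq (.op (.const 3 1)) <| forVerts 4 <| forVerts 5 <| forVerts 6 checkTriple

theorem isAnswer_step {τ : State} {P : Prop} {Q : Fin n → Prop} {v : Fin n}
    (h : IsAnswer τ ((P ∨ ∃ w : Fin n, (w : ℕ) < v ∧ Q w) ∨ Q v)) :
    IsAnswer τ (P ∨ ∃ w : Fin n, (w : ℕ) < v + 1 ∧ Q w) := by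
  refine h.congr rfl ?_
  rw [or_assoc]
  refine or_congr_right ⟨?_, ?_⟩
  · rintro (⟨w, hw, h⟩ | h)
    · exact ⟨w, by omega, h⟩
    · exact ⟨v, by omega, h⟩
  · rintro ⟨w, hw, h⟩
    rcases (show (w : ℕ) < v ∨ (w : ℕ) = v by omega) with hw | hw
    · exact Or.inl ⟨w, hw, h⟩
    · exact Or.inr (Fin.ext hw ▸ h)

/-- Rule for a loop over all vertices that asks a question for each of them. -/
theorem Runs.forVerts_isAnswer {r : ℕ} {p : Prog} {σ : State} {P : Prop} (Q : Fin n → Prop)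
    (c : ℕ) (hσ : HasInput L σ) (hr : r ∉ p.regs) (hr1 : 1 ≠ r)
    (hsafe : Safe (r :: p.regs) p.arrs) (hP : IsAnswer σ P)
    (hp : ∀ (v : Fin n) (τ : State) (P : Prop), HasInput L τ →
      AgreeOutside (r :: p.regs) p.arrs σ τ → IsAnswer τ P → τ.reg r = v →
      Runs p τ fun t υ => t ≤ c ∧ IsAnswer υ (P ∨ Q v)) :
    Runs (RAM.forVerts r p) σ fun t τ => t ≤ n * (c + 2) + 2 ∧ IsAnswer τ (P ∨ ∃ v, Q v) := by
  refine (Runs.forVerts (L := L)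
    (fun i τ => IsAnswer τ (P ∨ ∃ v : Fin n, (v : ℕ) < i ∧ Q v)) (fun _ => c) hσ hr hsafe ?_
    (by simpa using hP) ?_).mono ?_
  · intro i τ x h
    exact h.congr (by simp [hr1]) Iff.rfl
  · intro v τ hτ hag h hv
    exact (hp v τ _ hτ hag h hv).mono fun t υ h => ⟨h.1, isAnswer_step h.2⟩
  · rintro t τ ⟨ht, h, -⟩
    exact ⟨by simpa using ht, by simpa using h⟩

theorem runs_detect (L : AdjLists G) :
    Runs detect L.input fun t τ =>
      t ≤ 1 + (n * (n * (n * (50 * (n + 2 * G.edgeSet.ncard + 1) + 2) + 2 + 2) + 2 + 2) + 2) ∧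
      IsAnswer τ (∃ b₁ b₂ b₃, G.IsLinkedTriangle b₁ b₂ b₃) := by
  rw [detect, runs_seq, runs_op, ← L.sum_length_nbrs]
  -- Register `2` contains `0` from the outset, so only the constant `1` has to be stored; likewise
  -- register `1` starts as the answer to `False`.
  have hin : HasInput L ((Op.const 3 1).apply L.input) :=
    ⟨by simp [Op.apply, AdjLists.input], by simp [Op.apply, AdjLists.input], by simp [Op.apply],
      rfl, rfl⟩
  have h0 : IsAnswer ((Op.const 3 1).apply L.input) False := by
    simp [IsAnswer, Op.apply, AdjLists.input]
  refine (Runs.forVerts_isAnswer (fun b₁ => ∃ b₂ b₃, G.IsLinkedTriangle b₁ b₂ b₃)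
    (n * (n * (50 * (n + ∑ v, (L.nbrs v).length + 1) + 2) + 2 + 2) + 2) hin (by decide)
    (by decide) (by decide) h0 ?_).mono ?_
  · intro b₁ τ₁ P₁ hin₁ _ hP₁ h4
    refine Runs.forVerts_isAnswer (fun b₂ => ∃ b₃, G.IsLinkedTriangle b₁ b₂ b₃)
      (n * (50 * (n + ∑ v, (L.nbrs v).length + 1) + 2) + 2) hin₁ (by decide)
      (by decide) (by decide) hP₁ ?_
    intro b₂ τ₂ P₂ hin₂ hag₂ hP₂ h5
    refine Runs.forVerts_isAnswer (fun b₃ => G.IsLinkedTriangle b₁ b₂ b₃)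
      (50 * (n + ∑ v, (L.nbrs v).length + 1)) hin₂ (by decide)
      (by decide) (by decide) hP₂ ?_
    intro b₃ τ₃ P₃ hin₃ hag₃ hP₃ h6
    exact runs_checkTriple hin₃
      ((hag₃.reg 4 (by decide)).trans ((hag₂.reg 4 (by decide)).trans h4))
      ((hag₃.reg 5 (by decide)).trans h5) h6 hP₃
  · rintro t τ ⟨ht, h⟩
    exact ⟨by omega, by simpa using h⟩

/-- For `n ≥ 1` each of `n`, `n ^ 2` and `n ^ 3` is at most `n ^ 3 * (n + m)`, so the coefficients
add up to at most `100 + 52 + 4 + 4 = 160`. For `n = 0` the additive `1` in the bound is needed. -/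
theorem detect_time_le (n m : ℕ) :
    1 + (n * (n * (n * (50 * (n + 2 * m + 1) + 2) + 2 + 2) + 2 + 2) + 2) ≤
      200 * (n ^ 3 * (n + m) + 1) := by
  rcases Nat.eq_zero_or_pos n with rfl | hn
  · simp
  · have h1 : n ≤ n ^ 3 * (n + m) := by nlinarith [Nat.pow_pos (n := 3) hn]
    have h2 : n ^ 2 ≤ n ^ 3 * (n + m) := by
      calc n ^ 2 ≤ n ^ 3 := Nat.pow_le_pow_right hn (by norm_num)
        _ ≤ n ^ 3 * (n + m) := Nat.le_mul_of_pos_right _ (by omega)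
    have h3 : n ^ 3 ≤ n ^ 3 * (n + m) := Nat.le_mul_of_pos_right _ (by omega)
    have h4 : n ^ 3 * (n + 2 * m) ≤ 2 * (n ^ 3 * (n + m)) := by
      rw [Nat.mul_left_comm]
      exact Nat.mul_le_mul_left _ (by omega)
    calc _ = 50 * (n ^ 3 * (n + 2 * m)) + 52 * n ^ 3 + 4 * n ^ 2 + 4 * n + 3 := by ring
      _ ≤ _ := by omega

end RAM

theorem mainTheorem8 :
    ∃ (A : RAM.Prog) (C : ℕ), ∀ (n : ℕ) (G : SimpleGraph (Fin n)) (L : AdjLists G),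
      ∃ (t : ℕ) (τ : RAM.State),
        RAM.Exec A L.input t τ ∧
        t ≤ C * (n ^ 3 * (n + G.edgeSet.ncard) + 1) ∧
        (τ.reg 1 = 0 ∨ τ.reg 1 = 1) ∧
        (τ.reg 1 = 1 ↔ G.ContainsPrism ∨ G.ContainsPyramid) ∧
        (¬ G.ContainsPyramid → (τ.reg 1 = 1 ↔ G.ContainsPrism)) ∧
        (G.IsBerge → ¬ G.ContainsPyramid ∧ (τ.reg 1 = 1 ↔ G.ContainsPrism)) := by
  refine ⟨RAM.detect, 200, fun n G L => ?_⟩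
  obtain ⟨t, τ, hexec, ht, hle, hans⟩ := RAM.runs_detect L
  rw [← SimpleGraph.containsPrism_or_containsPyramid_iff] at hans
  have hfree : ¬ G.ContainsPyramid → (τ.reg 1 = 1 ↔ G.ContainsPrism) :=
    fun h => by rw [hans, or_iff_left h]
  exact ⟨t, τ, hexec, ht.trans (RAM.detect_time_le _ _), by omega, hans, hfree,
    fun hG => ⟨hG.not_containsPyramid, hfree hG.not_containsPyramid⟩⟩
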